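/- Let $\Gamma$ be a group or a monoid. For a commutative ring $R$ and $P\in M_2(R)$ put $m(P)=\mathrm{tr}(P)^2-4\det(P)$. A ($2$-dimensional) representation of $\Gamma$ on a scheme $X$ is a monoid homomorphism $\rho:\Gamma\to M_2(\Gamma(X,\mathcal O_X))$. Two representations $\rho,\rho'$ on $X$ are equivalent, $\rho\sim\rho'$, if there is a $\Gamma(X,\mathcal O_X)$-algebra automorphism $\sigma$ of $M_2(\Gamma(X,\mathcal O_X))$ with $\sigma(\rho(\gamma))=\rho'(\gamma)$ for all $\gamma\in\Gamma$. The representation $\rho$ has semi-simple mold if the subsheaf $\mathcal A=\mathcal O_X[\rho(\Gamma)]$ of $\mathcal O_X$-algebras of $M_2(\mathcal O_X)$ generated by $\rho(\Gamma)$ is a rank $2$ mold (that is, $M_2(\mathcal O_X)/\mathcal A$ is locally free, and $\mathcal A$ has rank $2$) and for each $x\in X$ there is $P\in\mathcal A_x$ such that $m(P)$ is non-zero in the residue field $k(x)$. Let $\mathcal{E}q\mathcal{SS}_2(\Gamma)$ be the sheafification, for the Zariski topology on the category of schemes, of the functor $$X\mapsto\{\text{representations of }\Gamma\text{ on }X\text{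 with semi-simple mold}\}/\sim .$$ A generalized representation with semi-simple mold of $\Gamma$ on $X$ is a family $\{(U_i,\rho_i)\}$ of open sets $U_i$ covering $X$ and representations $\rho_i$ with semi-simple mold on $U_i$ such that for all $i,j$ and each $x\in U_i\cap U_j$ there are a neighbourhood $V\subseteq U_i\cap U_j$ of $x$ and $P\in GL_2(\Gamma(V,\mathcal O_X))$ with $P^{-1}\rho_i(\gamma)P=\rho_j(\gamma)$ on $V$ for all $\gamma\in\Gamma$. Two of these are equivalent if their union is again a generalized representation with semi-simple mold. Let $A_2(\Gamma)$ be the commutative ring carrying the universal representation $\sigma_\Gamma:\Gamma\to M_2(A_2(\Gamma))$, and let $A_2(\Gamma)_{\mathrm{rk}\le2}$ be its quotient by the ideal generated by all $3\times3$ minors of the $4\times3$ matrices whose columns are the coordinate vectors of $\sigma_\Gamma(\alpha),\sigma_\Gamma(\beta),\sigma_\Gamma(\gamma)$, for $\alpha,\beta,\gamma\in\Gamma$. Let $A_2(\Gamma)^{\mathrm{Ch}}_{\mathrm{rk}\le2}$ be the subring of $A_2(\Gamma)_{\mathrm{rk}\le2}$ generated by all $\mathrm{tr}(\sigma_\Gamma(\gamma))$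 and $\det(\sigma_\Gamma(\gamma))$, $\gamma\in\Gamma$, and let $$\mathrm{Ch}_2(\Gamma)_{\mathrm{s.s.}}=\bigcup_{\gamma\in\Gamma}\mathrm{Spec}\,\bigl(A_2(\Gamma)^{\mathrm{Ch}}_{\mathrm{rk}\le2}\bigr)_{m(\sigma_\Gamma(\gamma))},$$ an open subscheme of $\mathrm{Spec}\,A_2(\Gamma)^{\mathrm{Ch}}_{\mathrm{rk}\le2}$. Theorem. (1) The scheme $\mathrm{Ch}_2(\Gamma)_{\mathrm{s.s.}}$ represents $\mathcal{E}q\mathcal{SS}_2(\Gamma)$, in such a way that the class of a representation $\rho$ with semi-simple mold on $X$ corresponds to the morphism $f:X\to\mathrm{Ch}_2(\Gamma)_{\mathrm{s.s.}}$ with $f^*\mathrm{tr}(\sigma_\Gamma(\gamma))=\mathrm{tr}(\rho(\gamma))$ and $f^*\det(\sigma_\Gamma(\gamma))=\det(\rho(\gamma))$ for all $\gamma\in\Gamma$. Equivalently, for every scheme $X$ the morphisms $f:X\to\mathrm{Ch}_2(\Gamma)_{\mathrm{s.s.}}$ correspond bijectively to the equivalence classes of generalized representations with semi-simple mold of $\Gamma$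 on $X$, where the class of $\{(U_i,\rho_i)\}$ corresponds to the $f$ whose restriction to each $U_i$ is the morphism given in this way by the traces and determinants of $\rho_i$. (2) $\mathrm{Ch}_2(\Gamma)_{\mathrm{s.s.}}$ is separated over $\mathbb Z$. (3) If $\Gamma$ is finitely generated (as a group or as a monoid), then $\mathrm{Ch}_2(\Gamma)_{\mathrm{s.s.}}$ is of finite type over $\mathbb Z$. -/

import Mathlib

open CategoryTheory AlgebraicGeometry Opposite
open scoped TensorProduct

universe u

namespace SSMold

/-! ## Matrices and discriminants -/

/-- The ring `M₂(R)`. -/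
abbrev Mat2 (R : Type*) : Type _ := Matrix (Fin 2) (Fin 2) R

/-- `m(P) = tr(P)² - 4 det(P)`. -/
def disc {R : Type*} [CommRing R] (P : Mat2 R) : R := P.trace ^ 2 - 4 * P.det

theorem disc_map {R S : Type*} [CommRing R] [CommRing S] (φ : R →+* S) (P : Mat2 R) :
    disc (φ.mapMatrix P) = φ (disc P) := by
  simp [disc, Matrix.trace_fin_two, Matrix.det_fin_two, map_ofNat φ 4]

/-! ## Subsheaves of algebras of `M₂(𝒪_X)` and molds -/

/-- Restriction of sections of `𝒪_X`. -/
abbrev res {X : Scheme.{u}} {V U : X.Opens} (h : V ≤ U) : Γ(X, U) →+* Γ(X, V) :=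
  (X.presheaf.map (homOfLE h).op).hom

/-- A subsheaf of `𝒪_X`-algebras of `M₂(𝒪_X)`. -/
structure AlgSubsheaf (X : Scheme.{u}) where
  /-- the sections over an open set -/
  sections (U : X.Opens) : Subalgebra Γ(X, U) (Mat2 Γ(X, U))
  res_mem {V U : X.Opens} (h : V ≤ U) {M : Mat2 Γ(X, U)} (hM : M ∈ sections U) :
    (res h).mapMatrix M ∈ sections V
  mem_of_locally {U : X.Opens} {M : Mat2 Γ(X, U)}
    (hM : ∀ x ∈ U, ∃ (V : X.Opens) (h : V ≤ U), x ∈ V ∧ (res h).mapMatrix M ∈ sections V) :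
    M ∈ sections U

/-- `𝒜 ⊆ M₂(𝒪_X)` is a mold of rank `2`: the quotient `M₂(𝒪_X)/𝒜` is locally free of rank
`2 = 4 - 2`. That is, `X` is covered by open sets `U` over which there are sections `e₀, e₁` of
`M₂(𝒪_X)` whose classes form a frame of `M₂(𝒪_X)/𝒜` over `U`: on every open `V ⊆ U`, every section
of `M₂(𝒪_X)` is, modulo `𝒜(V)`, a unique linear combination of `e₀, e₁`. -/
def AlgSubsheaf.IsRankTwoMold {X : Scheme.{u}} (A : AlgSubsheaf X) : Prop :=
  ∀ x : X, ∃ U : X.Opens, x ∈ U ∧ ∃ e : Fin 2 → Mat2 Γ(X, U),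
    ∀ (V : X.Opens) (h : V ≤ U) (M : Mat2 Γ(X, V)),
      ∃! c : Fin 2 → Γ(X, V), M - ∑ i, c i • (res h).mapMatrix (e i) ∈ A.sections V

/-- A rank `2` mold `𝒜` is semi-simple if for each `x ∈ X` there is a germ `P ∈ 𝒜_x` such that
`m(P)` does not vanish in the residue field `k(x)`. -/
def AlgSubsheaf.IsSemisimpleMold {X : Scheme.{u}} (A : AlgSubsheaf X) : Prop :=
  A.IsRankTwoMold ∧ ∀ x : X, ∃ (U : X.Opens) (hx : x ∈ U),
    ∃ P ∈ A.sections U, (X.evaluation U x hx).hom (disc P) ≠ 0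

/-! ## Representations on schemes -/

/-- Two-dimensional representations of the monoid `G` on the scheme `X`. -/
abbrev Rep2 (G : Type u) [Monoid G] (X : Scheme.{u}) : Type u := G →* Mat2 Γ(X, ⊤)

section

variable {G : Type u} [Monoid G] {X Y Z : Scheme.{u}}

/-- The matrix `ρ(g)`, restricted to `U`. -/
def Rep2.onOpen (ρ : Rep2 G X) (U : X.Opens) (g : G) : Mat2 Γ(X, U) :=
  (res (le_top : U ≤ ⊤)).mapMatrix (ρ g)

theorem res_res {W V U : X.Opens} (h : W ≤ V) (h' : V ≤ U) (M : Mat2 Γ(X, U)) :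
    (res h).mapMatrix ((res h').mapMatrix M) = (res (h.trans h')).mapMatrix M := by
  ext i j
  simp only [RingHom.mapMatrix_apply, Matrix.map_apply]
  rw [← CommRingCat.comp_apply, ← Functor.map_comp]
  rfl

theorem res_onOpen (ρ : Rep2 G X) {V U : X.Opens} (h : V ≤ U) (g : G) :
    (res h).mapMatrix (ρ.onOpen U g) = ρ.onOpen V g :=
  res_res _ _ _

theorem mapMatrix_mem_adjoin {R S : Type*} [CommRing R] [CommRing S] (φ : R →+* S)
    {ι : Type*} (a : ι → Mat2 R) (b : ι → Mat2 S) (hab : ∀ i, φ.mapMatrix (a i) = b i)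
    {M : Mat2 R} (hM : M ∈ Algebra.adjoin R (Set.range a)) :
    φ.mapMatrix M ∈ Algebra.adjoin S (Set.range b) := by
  induction hM using Algebra.adjoin_induction with
  | mem x hx =>
    obtain ⟨i, rfl⟩ := hx
    rw [hab]
    exact Algebra.subset_adjoin ⟨i, rfl⟩
  | algebraMap r =>
    have : φ.mapMatrix (algebraMap R (Mat2 R) r) = algebraMap S (Mat2 S) (φ r) := by
      ext i j
      simp [Matrix.algebraMap_matrix_apply, apply_ite φ]
    rw [this]
    exact Subalgebra.algebraMap_mem _ _
  | add x y _ _ hx hy => rw [map_add]; exact add_mem hx hy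
  | mul x y _ _ hx hy => rw [map_mul]; exact mul_mem hx hy

/-- `𝒪_X[ρ(G)]`: the subsheaf of `𝒪_X`-algebras of `M₂(𝒪_X)` generated by `ρ(G)`. Its sections are
the matrices that locally lie in the subalgebra generated by the restrictions of `ρ(g)`, `g ∈ G`. -/
def Rep2.generated (ρ : Rep2 G X) : AlgSubsheaf X where
  sections U :=
    { carrier := {M | ∀ x ∈ U, ∃ (V : X.Opens) (h : V ≤ U), x ∈ V ∧
        (res h).mapMatrix M ∈ Algebra.adjoin Γ(X, V) (Set.range (ρ.onOpen V))}
      mul_mem' := by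
        intro M N hM hN x hx
        obtain ⟨V, h, hxV, hV⟩ := hM x hx
        obtain ⟨W, h', hxW, hW⟩ := hN x hx
        refine ⟨V ⊓ W, inf_le_left.trans h, ⟨hxV, hxW⟩, ?_⟩
        rw [map_mul]
        refine mul_mem ?_ ?_
        · rw [← res_res inf_le_left h]
          exact mapMatrix_mem_adjoin _ _ _ (res_onOpen ρ _) hV
        · rw [← res_res inf_le_right h']
          exact mapMatrix_mem_adjoin _ _ _ (res_onOpen ρ _) hW
      add_mem' := by
        intro M N hM hN x hx
        obtain ⟨V, h, hxV, hV⟩ := hM x hx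
        obtain ⟨W, h', hxW, hW⟩ := hN x hx
        refine ⟨V ⊓ W, inf_le_left.trans h, ⟨hxV, hxW⟩, ?_⟩
        rw [map_add]
        refine add_mem ?_ ?_
        · rw [← res_res inf_le_left h]
          exact mapMatrix_mem_adjoin _ _ _ (res_onOpen ρ _) hV
        · rw [← res_res inf_le_right h']
          exact mapMatrix_mem_adjoin _ _ _ (res_onOpen ρ _) hW
      algebraMap_mem' := by
        intro r x hx
        refine ⟨U, le_rfl, hx, ?_⟩
        have : (res (le_refl U)).mapMatrix (algebraMap Γ(X, U) (Mat2 Γ(X, U)) r) =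
            algebraMap Γ(X, U) (Mat2 Γ(X, U)) (res (le_refl U) r) := by
          ext i j
          simp only [RingHom.mapMatrix_apply, Matrix.map_apply, Matrix.algebraMap_matrix_apply,
            apply_ite (res (le_refl U)), map_zero]
          rfl
        rw [this]
        exact Subalgebra.algebraMap_mem _ _ }
  res_mem := by
    intro V U h M hM x hx
    obtain ⟨W, h', hxW, hW⟩ := hM x (h hx)
    refine ⟨V ⊓ W, inf_le_left, ⟨hx, hxW⟩, ?_⟩
    rw [res_res, ← res_res inf_le_right h']
    exact mapMatrix_mem_adjoin _ _ _ (res_onOpen ρ _) hW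
  mem_of_locally := by
    intro U M hM x hx
    obtain ⟨V, h, hxV, hV⟩ := hM x hx
    obtain ⟨W, h', hxW, hW⟩ := hV x hxV
    refine ⟨W, h'.trans h, hxW, ?_⟩
    rw [← res_res]
    exact hW

theorem Rep2.mem_generated (ρ : Rep2 G X) {U : X.Opens} {M : Mat2 Γ(X, U)} :
    M ∈ ρ.generated.sections U ↔ ∀ x ∈ U, ∃ (V : X.Opens) (h : V ≤ U), x ∈ V ∧
      (res h).mapMatrix M ∈ Algebra.adjoin Γ(X, V) (Set.range (ρ.onOpen V)) :=
  Iff.rfl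

/-- `ρ` is a representation with semi-simple mold. -/
def Rep2.HasSemisimpleMold (ρ : Rep2 G X) : Prop :=
  ρ.generated.IsSemisimpleMold

/-- `ρ ∼ ρ'`: some `Γ(X, 𝒪_X)`-algebra automorphism of `M₂(Γ(X, 𝒪_X))` carries `ρ` to `ρ'`. -/
def Rep2.Equivalent (ρ ρ' : Rep2 G X) : Prop :=
  ∃ σ : Mat2 Γ(X, ⊤) ≃ₐ[Γ(X, ⊤)] Mat2 Γ(X, ⊤), ∀ g, σ (ρ g) = ρ' g

/-- The pullback `f^*ρ`. -/
def Rep2.pullback (f : Y ⟶ X) (ρ : Rep2 G X) : Rep2 G Y :=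
  (f.appTop.hom.mapMatrix : Mat2 Γ(X, ⊤) →+* Mat2 Γ(Y, ⊤)).toMonoidHom.comp ρ

theorem Rep2.appLE_onOpen (f : Y ⟶ X) (ρ : Rep2 G X) {U : X.Opens} {V : Y.Opens}
    (e : V ≤ f ⁻¹ᵁ U) (g : G) :
    (f.appLE U V e).hom.mapMatrix (ρ.onOpen U g) = (ρ.pullback f).onOpen V g := by
  ext i j
  simp only [Rep2.onOpen, Rep2.pullback, RingHom.mapMatrix_apply, Matrix.map_apply,
    MonoidHom.comp_apply, RingHom.toMonoidHom_eq_coe, MonoidHom.coe_coe]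
  rw [← CommRingCat.comp_apply, Scheme.Hom.map_appLE, ← Scheme.Hom.appLE_map f
    (le_refl (f ⁻¹ᵁ ⊤)) (homOfLE (le_top : V ≤ f ⁻¹ᵁ ⊤)).op, Scheme.Hom.appLE_eq_app]
  rfl

theorem appLE_res (f : Y ⟶ X) {U U' : X.Opens} {V V' : Y.Opens} (hU : U' ≤ U) (hV : V' ≤ V)
    (e : V ≤ f ⁻¹ᵁ U) (e' : V' ≤ f ⁻¹ᵁ U') (s : Γ(X, U)) :
    f.appLE U' V' e' (res hU s) = res hV (f.appLE U V e s) := by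
  rw [← CommRingCat.comp_apply, ← CommRingCat.comp_apply, Scheme.Hom.map_appLE,
    Scheme.Hom.appLE_map]

theorem Rep2.appLE_mem_generated (f : Y ⟶ X) (ρ : Rep2 G X) {U : X.Opens} {V : Y.Opens}
    (e : V ≤ f ⁻¹ᵁ U) {M : Mat2 Γ(X, U)} (hM : M ∈ ρ.generated.sections U) :
    (f.appLE U V e).hom.mapMatrix M ∈ (ρ.pullback f).generated.sections V := by
  intro y hy
  obtain ⟨W, h, hxW, hW⟩ := hM (f y) (e hy)
  refine ⟨V ⊓ f ⁻¹ᵁ W, inf_le_left, ⟨hy, hxW⟩, ?_⟩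
  have key : (res (inf_le_left : V ⊓ f ⁻¹ᵁ W ≤ V)).mapMatrix ((f.appLE U V e).hom.mapMatrix M) =
      (f.appLE W (V ⊓ f ⁻¹ᵁ W) inf_le_right).hom.mapMatrix ((res h).mapMatrix M) := by
    ext i j
    exact (appLE_res f h inf_le_left e inf_le_right (M i j)).symm
  rw [key]
  exact mapMatrix_mem_adjoin _ _ _ (fun g => ρ.appLE_onOpen f _ g) hW

theorem Rep2.onOpen_mem_generated (ρ : Rep2 G X) (U : X.Opens) (g : G) :
    ρ.onOpen U g ∈ ρ.generated.sections U := by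
  intro x hx
  refine ⟨U, le_rfl, hx, ?_⟩
  rw [res_onOpen]
  exact Algebra.subset_adjoin ⟨g, rfl⟩

/-- As `ρ(G)` is a submonoid, the algebra it generates is its linear span. -/
theorem Rep2.adjoin_onOpen (ρ : Rep2 G X) (U : X.Opens) :
    Subalgebra.toSubmodule (Algebra.adjoin Γ(X, U) (Set.range (ρ.onOpen U))) =
      Submodule.span Γ(X, U) (Set.range (ρ.onOpen U)) := by
  let φ : G →* Mat2 Γ(X, U) :=
    ((res (le_top : U ≤ ⊤)).mapMatrix : Mat2 Γ(X, ⊤) →+* Mat2 Γ(X, U)).toMonoidHom.comp ρ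
  have : Set.range (ρ.onOpen U) = (MonoidHom.mrange φ : Set (Mat2 Γ(X, U))) := by
    ext M; rfl
  rw [Algebra.adjoin_eq_span, this, Submonoid.closure_eq]

/-- An explicit linear functional on `M₂(R)`. -/
def functional {R : Type*} [CommRing R] (a : Fin 2 → Fin 2 → R) : Mat2 R →ₗ[R] R where
  toFun M := ∑ i, ∑ j, M i j * a i j
  map_add' M N := by simp [Fin.sum_univ_two]; ring
  map_smul' r M := by simp [Fin.sum_univ_two]; ring

theorem functional_map {R S : Type*} [CommRing R] [CommRing S] (φ : R →+* S)
    (a : Fin 2 → Fin 2 → R) (M : Mat2 R) :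
    functional (fun i j => φ (a i j)) (φ.mapMatrix M) = φ (functional a M) := by
  simp [functional]

theorem sub_functional_eq {R : Type*} [CommRing R] (a : Fin 2 → Fin 2 → Fin 2 → R)
    (e : Fin 2 → Mat2 R) (M : Mat2 R) :
    M - ∑ i, functional (a i) M • e i =
      ∑ p, ∑ q, M p q • (Matrix.single p q 1 - ∑ i, a i p q • e i) := by
  ext k l
  fin_cases k <;> fin_cases l <;>
    simp [functional, Fin.sum_univ_two] <;> ring

theorem mapMatrix_single_sub {R S : Type*} [CommRing R] [CommRing S] (φ : R →+* S)
    (c : Fin 2 → R) (e : Fin 2 → Mat2 R) (p q : Fin 2) :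
    φ.mapMatrix (Matrix.single p q 1 - ∑ i, c i • e i) =
      Matrix.single p q 1 - ∑ i, φ (c i) • φ.mapMatrix (e i) := by
  ext k l
  simp [Fin.sum_univ_two, Matrix.single_apply, apply_ite φ]

theorem res_refl {U : X.Opens} (M : Mat2 Γ(X, U)) : (res (le_refl U)).mapMatrix M = M := by
  ext i j
  change (X.presheaf.map (𝟙 (op U))) (M i j) = M i j
  rw [X.presheaf.map_id]
  rfl

theorem Rep2.functional_eq_zero (ρ : Rep2 G X) {U : X.Opens} (a : Fin 2 → Fin 2 → Γ(X, U))
    (ha : ∀ g, functional a (ρ.onOpen U g) = 0) {M : Mat2 Γ(X, U)}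
    (hM : M ∈ ρ.generated.sections U) : functional a M = 0 := by
  refine TopCat.Presheaf.section_ext X.sheaf U _ _ fun x hx => ?_
  obtain ⟨V, h, hxV, hV⟩ := hM x hx
  have h0 : functional (fun i j => res h (a i j)) ((res h).mapMatrix M) = 0 := by
    rw [← Subalgebra.mem_toSubmodule, ρ.adjoin_onOpen] at hV
    have : Submodule.span Γ(X, V) (Set.range (ρ.onOpen V)) ≤
        LinearMap.ker (functional (fun i j => res h (a i j))) := by
      rw [Submodule.span_le]
      rintro _ ⟨g, rfl⟩
      change functional _ _ = 0
      rw [← res_onOpen ρ h, functional_map, ha, map_zero]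
    exact this hV
  rw [functional_map] at h0
  have h1 := X.presheaf.germ_res_apply (homOfLE h) x hxV (functional a M)
  have h2 := X.presheaf.germ_res_apply (homOfLE h) x hxV (0 : Γ(X, U))
  rw [map_zero] at h2
  exact (h1.symm.trans (congrArg _ h0)).trans h2

theorem Rep2.isRankTwoMold_pullback (f : Y ⟶ X) (ρ : Rep2 G X)
    (h : ρ.generated.IsRankTwoMold) : (ρ.pullback f).generated.IsRankTwoMold := by
  intro y
  obtain ⟨U, hxU, e, he⟩ := h (f y)
  have heU : ∀ M : Mat2 Γ(X, U), ∃! c : Fin 2 → Γ(X, U),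
      M - ∑ i, c i • e i ∈ ρ.generated.sections U := by
    intro M
    have := he U le_rfl M
    simpa only [res_refl] using this
  choose c hc hcu using heU
  let a : Fin 2 → Fin 2 → Fin 2 → Γ(X, U) := fun i p q => c (Matrix.single p q 1) i
  have ha : ∀ M, c M = fun i => functional (a i) M := by
    intro M
    refine (hcu M _ ?_).symm
    beta_reduce
    rw [sub_functional_eq a e M]
    exact sum_mem fun p _ => sum_mem fun q _ => Subalgebra.smul_mem _ (hc (Matrix.single p q 1)) _
  have hzero : ∀ g i, functional (a i) (ρ.onOpen U g) = 0 := by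
    intro g i
    have h1 : c (ρ.onOpen U g) = 0 := by
      refine (hcu _ 0 ?_).symm
      simpa using ρ.onOpen_mem_generated U g
    rw [ha] at h1
    exact congrFun h1 i
  have hdual : ∀ i j, functional (a i) (e j) = if i = j then 1 else 0 := by
    intro i j
    have h1 : c (e j) = fun i => if i = j then 1 else 0 := by
      refine (hcu _ _ ?_).symm
      simp
    rw [ha] at h1
    exact congrFun h1 i
  refine ⟨f ⁻¹ᵁ U, hxU, fun i => (f.appLE U (f ⁻¹ᵁ U) le_rfl).hom.mapMatrix (e i), ?_⟩
  intro V hV M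
  have hres : ∀ i, (res hV).mapMatrix ((f.appLE U (f ⁻¹ᵁ U) le_rfl).hom.mapMatrix (e i)) =
      (f.appLE U V hV).hom.mapMatrix (e i) := by
    intro i
    ext k l
    refine (appLE_res f le_rfl hV le_rfl hV (e i k l)).symm.trans ?_
    exact congrArg (f.appLE U V hV) (congrFun (congrFun (res_refl (e i)) k) l)
  simp only [hres]
  let φ := (f.appLE U V hV).hom
  let a' : Fin 2 → Fin 2 → Fin 2 → Γ(Y, V) := fun i p q => φ (a i p q)
  refine ⟨fun i => functional (a' i) M, ?_, ?_⟩
  · beta_reduce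
    rw [sub_functional_eq a' _ M]
    refine sum_mem fun p _ => sum_mem fun q _ => Subalgebra.smul_mem _ ?_ _
    have h1 := ρ.appLE_mem_generated f hV (hc (Matrix.single p q 1))
    rw [mapMatrix_single_sub] at h1
    exact h1
  · intro d hd
    funext i
    have h1 : functional (a' i) (M - ∑ j, d j • φ.mapMatrix (e j)) = 0 := by
      refine (ρ.pullback f).functional_eq_zero (a' i) (fun g => ?_) hd
      rw [← ρ.appLE_onOpen f hV]
      exact (functional_map φ (a i) _).trans (by rw [hzero, map_zero])
    have h2 : ∀ j, functional (a' i) (φ.mapMatrix (e j)) = if i = j then 1 else 0 := by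
      intro j
      refine (functional_map φ (a i) _).trans ?_
      rw [hdual]
      split_ifs <;> simp
    rw [map_sub, map_sum, sub_eq_zero] at h1
    rw [h1]
    simp only [map_smul, h2, smul_eq_mul, mul_ite, mul_one, mul_zero, Finset.sum_ite_eq,
      Finset.mem_univ, if_true]

theorem Rep2.HasSemisimpleMold.pullback (f : Y ⟶ X) {ρ : Rep2 G X}
    (h : ρ.HasSemisimpleMold) : (ρ.pullback f).HasSemisimpleMold := by
  refine ⟨ρ.isRankTwoMold_pullback f h.1, fun y => ?_⟩
  obtain ⟨U, hx, P, hP, hne⟩ := h.2 (f y)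
  refine ⟨f ⁻¹ᵁ U, hx, _, ρ.appLE_mem_generated f le_rfl hP, ?_⟩
  rw [disc_map]
  erw [Scheme.evaluation_ne_zero_iff_mem_basicOpen] at hne ⊢
  rw [Scheme.basicOpen_appLE]
  exact ⟨hx, hne⟩

theorem exists_baseChange {R S : Type*} [CommRing R] [CommRing S] (φ : R →+* S)
    (σ : Mat2 R ≃ₐ[R] Mat2 R) :
    ∃ τ : Mat2 S ≃ₐ[S] Mat2 S, ∀ M, τ (φ.mapMatrix M) = φ.mapMatrix (σ M) := by
  let := φ.toAlgebra
  let t : Mat2 S ≃ₐ[S] TensorProduct R S (Mat2 R) :=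
    AlgEquiv.ofRingEquiv (f := (matrixEquivTensor (Fin 2) R S).toRingEquiv) (by
      intro s
      change matrixEquivTensor (Fin 2) R S _ = _
      rw [← AlgEquiv.eq_symm_apply, Algebra.TensorProduct.algebraMap_apply,
        matrixEquivTensor_apply_symm]
      ext i j
      by_cases hij : i = j <;>
        simp [Matrix.algebraMap_matrix_apply, hij])
  have ht : ∀ M : Mat2 R, t.symm (1 ⊗ₜ M) = φ.mapMatrix M := by
    intro M
    change (matrixEquivTensor (Fin 2) R S).symm _ = _
    rw [matrixEquivTensor_apply_symm, one_smul]
    rfl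
  refine ⟨(t.trans (Algebra.TensorProduct.congr AlgEquiv.refl σ)).trans t.symm, fun M => ?_⟩
  rw [← ht, ← ht]
  simp

theorem Rep2.Equivalent.pullback (f : Y ⟶ X) {ρ ρ' : Rep2 G X} (h : ρ.Equivalent ρ') :
    (ρ.pullback f).Equivalent (ρ'.pullback f) := by
  obtain ⟨σ, hσ⟩ := h
  obtain ⟨τ, hτ⟩ := exists_baseChange f.appTop.hom σ
  refine ⟨τ, fun g => ?_⟩
  have := hτ (ρ g)
  rw [hσ] at this
  exact this

theorem Rep2.pullback_id (ρ : Rep2 G X) : ρ.pullback (𝟙 X) = ρ := by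
  ext g i j
  simp [Rep2.pullback]

theorem Rep2.pullback_comp (f : Y ⟶ X) (h : Z ⟶ Y) (ρ : Rep2 G X) :
    ρ.pullback (h ≫ f) = (ρ.pullback f).pullback h := by
  ext g i j
  change ((h ≫ f).appTop).hom (ρ g i j) = h.appTop.hom (f.appTop.hom (ρ g i j))
  rw [Scheme.Hom.comp_appTop]
  rfl

end

/-! ## The functor of equivalence classes of representations with semi-simple mold -/

/-- Representations of `G` on `X` with semi-simple mold. -/
def SSRep (G : Type u) [Monoid G] (X : Scheme.{u}) : Type u :=
  {ρ : Rep2 G X // ρ.HasSemisimpleMold}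

section

variable {G : Type u} [Monoid G] {X Y : Scheme.{u}}

/-- The pullback of a representation with semi-simple mold. -/
def SSRep.pullback (f : Y ⟶ X) (ρ : SSRep G X) : SSRep G Y :=
  ⟨ρ.1.pullback f, ρ.2.pullback f⟩

/-- The equivalence relation `∼` on representations with semi-simple mold. -/
instance SSRep.setoid (G : Type u) [Monoid G] (X : Scheme.{u}) : Setoid (SSRep G X) where
  r ρ ρ' := ρ.1.Equivalent ρ'.1
  iseqv :=
    { refl := fun _ => ⟨AlgEquiv.refl, fun _ => rfl⟩
      symm := by
        rintro ρ ρ' ⟨σ, hσ⟩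
        exact ⟨σ.symm, fun g => by rw [← hσ, AlgEquiv.symm_apply_apply]⟩
      trans := by
        rintro ρ ρ' ρ'' ⟨σ, hσ⟩ ⟨τ, hτ⟩
        exact ⟨σ.trans τ, fun g => by rw [AlgEquiv.trans_apply, hσ, hτ]⟩ }

end

/-- The presheaf `X ↦ {representations of G on X with semi-simple mold} / ∼` on schemes. -/
def preEqSS (G : Type u) [Monoid G] : Scheme.{u}ᵒᵖ ⥤ Type u where
  obj X := Quotient (SSRep.setoid G X.unop)
  map f := TypeCat.ofHom (Quotient.map (SSRep.pullback f.unop)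
    fun _ _ h => Rep2.Equivalent.pullback f.unop h)
  map_id X := by
    ext q
    induction q using Quotient.inductionOn with
    | h ρ => exact congrArg _ (Subtype.ext (Rep2.pullback_id ρ.1))
  map_comp f g := by
    ext q
    induction q using Quotient.inductionOn with
    | h ρ => exact congrArg _ (Subtype.ext (Rep2.pullback_comp f.unop g.unop ρ.1))

/-- `EqSS₂(G)`: the sheafification of `preEqSS G` for the Zariski topology. (Since the category of
schemes is large, the presheaf is first regarded as taking values in the next universe.) -/
noncomputable def eqSS (G : Type u) [Monoid G] : Scheme.{u}ᵒᵖ ⥤ Type (u + 1) :=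
  sheafify Scheme.zariskiTopology.{u} (preEqSS G ⋙ uliftFunctor.{u + 1})

/-- The section of `EqSS₂(G)` over `X` given by a representation with semi-simple mold on `X`. -/
noncomputable def eqSSClass {G : Type u} [Monoid G] {X : Scheme.{u}} (ρ : SSRep G X) :
    (eqSS G).obj (op X) :=
  (toSheafify Scheme.zariskiTopology.{u} (preEqSS G ⋙ uliftFunctor.{u + 1})).app (op X)
    (ULift.up (Quotient.mk (SSRep.setoid G X) ρ))

/-! ## Generalized representations with semi-simple mold -/

/-- A family `s` of pairs `(U, ρ)` of an open set `U ⊆ X` and a representation with semi-simple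
mold `ρ` on `U` is a generalized representation with semi-simple mold if the sets `U` cover `X`
and any two members are locally conjugate on the overlap. -/
structure IsGenRep {G : Type u} [Monoid G] {X : Scheme.{u}}
    (s : Set (Σ U : X.Opens, SSRep G (U : Scheme.{u}))) : Prop where
  covers : ∀ x : X, ∃ p ∈ s, x ∈ p.1
  locally_conj : ∀ p ∈ s, ∀ q ∈ s, ∀ x : X, x ∈ p.1 → x ∈ q.1 →
    ∃ (V : X.Opens) (hp : V ≤ p.1) (hq : V ≤ q.1), x ∈ V ∧
      ∃ P : GL (Fin 2) Γ((V : Scheme.{u}), ⊤), ∀ g : G,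
        (↑P⁻¹ : Mat2 Γ((V : Scheme.{u}), ⊤)) * (p.2.pullback (X.homOfLE hp)).1 g * P.1 =
          (q.2.pullback (X.homOfLE hq)).1 g

/-- Generalized representations with semi-simple mold of `G` on `X`. -/
def GenRep (G : Type u) [Monoid G] (X : Scheme.{u}) : Type u :=
  {s : Set (Σ U : X.Opens, SSRep G (U : Scheme.{u})) // IsGenRep s}

/-- Two generalized representations are equivalent if their union is again one. -/
def GenRep.Equivalent {G : Type u} [Monoid G] {X : Scheme.{u}} (s t : GenRep G X) : Prop :=
  IsGenRep (s.1 ∪ t.1)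

/-! ## The representation variety -/

section

variable (G : Type u) [Monoid G]

/-- The polynomial ring over `ℤ` in the indeterminates `x(g, i, j)`. -/
abbrev PolyRing : Type u := MvPolynomial (G × Fin 2 × Fin 2) ℤ

variable {G} in
/-- The matrix of indeterminates attached to `g`. -/
noncomputable def genericMatrix (g : G) : Mat2 (PolyRing G) :=
  Matrix.of fun i j => MvPolynomial.X (g, i, j)

/-- The relations saying that `g ↦ (x(g, i, j))` is a monoid homomorphism. -/
noncomputable def relIdeal : Ideal (PolyRing G) :=
  Ideal.span ({a | ∃ i j, a = (genericMatrix (1 : G) - 1) i j} ∪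
    {a | ∃ (g h : G) (i j : Fin 2),
      a = (genericMatrix (g * h) - genericMatrix g * genericMatrix h) i j})

/-- `A₂(G)`: the coordinate ring of the representation variety of degree `2`. -/
abbrev A2 : Type u := PolyRing G ⧸ relIdeal G

/-- The universal representation `σ_G : G → M₂(A₂(G))`. -/
noncomputable def univRep : G →* Mat2 (A2 G) where
  toFun g := (Ideal.Quotient.mk (relIdeal G)).mapMatrix (genericMatrix g)
  map_one' := by
    rw [← map_one (Ideal.Quotient.mk (relIdeal G)).mapMatrix]
    ext i j
    exact Ideal.Quotient.eq.mpr (Ideal.subset_span (Or.inl ⟨i, j, rfl⟩))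
  map_mul' g h := by
    rw [← map_mul]
    ext i j
    exact Ideal.Quotient.eq.mpr (Ideal.subset_span (Or.inr ⟨g, h, i, j, rfl⟩))

/-- The universal property of `A₂(G)`: representations of `G` over a commutative ring `R` are the
same as ring homomorphisms `A₂(G) → R`. -/
theorem existsUnique_A2_lift {R : Type*} [CommRing R] (ρ : G →* Mat2 R) :
    ∃! φ : A2 G →+* R, ∀ g, φ.mapMatrix (univRep G g) = ρ g := by
  let ψ : PolyRing G →+* R := MvPolynomial.eval₂Hom (Int.castRingHom R) fun x => ρ x.1 x.2.1 x.2.2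
  have hψ : ∀ g, ψ.mapMatrix (genericMatrix g) = ρ g := by
    intro g
    ext i j
    simp [ψ, genericMatrix]
  have hker : ∀ a ∈ relIdeal G, ψ a = 0 := by
    intro a ha
    have hle : relIdeal G ≤ RingHom.ker ψ := by
      refine Ideal.span_le.mpr ?_
      rintro _ (⟨i, j, rfl⟩ | ⟨g, h, i, j, rfl⟩)
      · change (ψ.mapMatrix (genericMatrix (1 : G) - 1)) i j = 0
        rw [map_sub, hψ, map_one, map_one, sub_self, Matrix.zero_apply]
      · change (ψ.mapMatrix (genericMatrix (g * h) - genericMatrix g * genericMatrix h)) i j = 0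
        rw [map_sub, map_mul, hψ, hψ, hψ, map_mul, sub_self, Matrix.zero_apply]
    exact hle ha
  refine ⟨Ideal.Quotient.lift _ ψ hker, fun g => ?_, fun φ hφ => ?_⟩
  · rw [← hψ]
    ext i j
    rfl
  · refine Ideal.Quotient.ringHom_ext (MvPolynomial.ringHom_ext (fun n => by simp) ?_)
    rintro ⟨g, i, j⟩
    have h1 := congrFun (congrFun (hφ g) i) j
    have h2 := congrFun (congrFun (hψ g) i) j
    simp only [univRep, genericMatrix, RingHom.mapMatrix_apply, Matrix.map_apply, Matrix.of_apply,
      MonoidHom.coe_mk, OneHom.coe_mk] at h1 h2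
    simp [h1, h2]

variable {G} in
/-- The `4 × 3` matrix whose columns are the coordinate vectors of `σ_G(a)`, `σ_G(b)`, `σ_G(c)`. -/
noncomputable def coordMatrix (a b c : G) : Matrix (Fin 2 × Fin 2) (Fin 3) (A2 G) :=
  Matrix.of fun ij k => univRep G (![a, b, c] k) ij.1 ij.2

/-- The ideal generated by all `3 × 3` minors of all the matrices `coordMatrix a b c`. -/
noncomputable def minorIdeal : Ideal (A2 G) :=
  Ideal.span {d | ∃ (a b c : G) (r : Fin 3 ↪ Fin 2 × Fin 2),
    d = ((coordMatrix a b c).submatrix r id).det}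

/-- `A₂(G)_{rk ≤ 2}`, the coordinate ring of the closed subscheme `Rep₂(G)_{rk ≤ 2}`. -/
abbrev A2rk : Type u := A2 G ⧸ minorIdeal G

/-- The universal representation over `A₂(G)_{rk ≤ 2}`. -/
noncomputable def univRepRk : G →* Mat2 (A2rk G) :=
  ((Ideal.Quotient.mk (minorIdeal G)).mapMatrix : Mat2 (A2 G) →+* _).toMonoidHom.comp (univRep G)

/-! ## The moduli scheme -/

/-- The subring of `A₂(G)_{rk ≤ 2}` generated by the traces and determinants of the `σ_G(g)`. -/
noncomputable def A2rkCh : Subring (A2rk G) :=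
  Subring.closure (Set.range (fun g => (univRepRk G g).trace) ∪
    Set.range (fun g => (univRepRk G g).det))

variable {G} in
/-- `tr σ_G(g)` as an element of the trace/determinant subring. -/
noncomputable def trCh (g : G) : A2rkCh G :=
  ⟨(univRepRk G g).trace, Subring.subset_closure (Or.inl ⟨g, rfl⟩)⟩

variable {G} in
/-- `det σ_G(g)` as an element of the trace/determinant subring. -/
noncomputable def detCh (g : G) : A2rkCh G :=
  ⟨(univRepRk G g).det, Subring.subset_closure (Or.inr ⟨g, rfl⟩)⟩

/-- `Ch₂(G)_{rk ≤ 2}`, the spectrum of the trace/determinant subring. -/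
noncomputable def chRk : Scheme.{u} := Spec (CommRingCat.of (A2rkCh G))

/-- The open subset of `Ch₂(G)_{rk ≤ 2}` that is the union over `g ∈ G` of the basic open sets
where `m(σ_G(g)) = tr(σ_G(g))² - 4 det(σ_G(g))` does not vanish. -/
noncomputable def chSSOpen : (chRk G).Opens :=
  ⨆ g : G, PrimeSpectrum.basicOpen (trCh g ^ 2 - 4 * detCh g)

/-- `Ch₂(G)_{s.s.} = ⋃_g Spec (A₂(G)_{rk ≤ 2}^{Ch})_{m(σ_G(g))}`. -/
noncomputable def chSS : Scheme.{u} := (chSSOpen G).toScheme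

/-- An element of the trace/determinant subring as a regular function on `Ch₂(G)_{s.s.}`. -/
noncomputable def chFun : A2rkCh G →+* Γ(chSS G, ⊤) :=
  ((Scheme.ΓSpecIso (CommRingCat.of (A2rkCh G))).inv ≫ (chSSOpen G).ι.appTop).hom

end

/-- The morphism `f : X ⟶ Ch₂(G)_{s.s.}` is the one given by the traces and determinants of `ρ`:
`f^*(tr σ_G(g)) = tr ρ(g)` and `f^*(det σ_G(g)) = det ρ(g)` for all `g`. -/
def IsCharacterOf {G : Type u} [Monoid G] {X : Scheme.{u}} (f : X ⟶ chSS G) (ρ : SSRep G X) :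
    Prop :=
  ∀ g : G, f.appTop.hom (chFun G (trCh g)) = (ρ.1 g).trace ∧
    f.appTop.hom (chFun G (detCh g)) = (ρ.1 g).det

/-- The structure morphism of a scheme to `Spec ℤ`. -/
noncomputable def toSpecZ (X : Scheme.{u}) : X ⟶ Spec (CommRingCat.of (ULift.{u} ℤ)) :=
  specULiftZIsTerminal.from X

end SSMold

/-!
Write `m(P) = tr(P)² - 4 det(P)` for `2 × 2` matrices. If `1`, `P`, `B` span a module of rank at
most `2`, then Cramer's rule gives `m(P) B = X • 1 + Y • P`, where `X` and `Y` are polynomials in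
traces of products of `P` and `B` (`MinorsVanish.disc_smul_eq`). Applied to the universal
representation over `A₂(G)_{rk ≤ 2}`, this has two consequences on the locus where `m(σ_G(c))` is
invertible for a fixed `c : G`.

* Replacing `σ_G(c)` by the companion matrix with the same trace and determinant in the formula
  for `σ_G(g)` yields a representation whose entries come from the subring of traces and
  determinants, `stdRep`; its traces and determinants are the given ones. So the character map is
  locally surjective (`exists_local_ssRep`).
* A representation `ρ` with this character is conjugate to the standard one by the matrix with
  columns `v`, `ρ(c) v` whenever `v` is a cyclic vector for `ρ(c)`. Since `m(ρ(c))` is nonzero in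
  each residue field, a cyclic vector exists near each point. So the character map is locally
  injective (`SSRep.SameCharacter.exists_conj`).

A representation with semi-simple mold satisfies the rank condition (`Rep2.minorsVanish`), and
near each point some `m(ρ(c))` is invertible (`Rep2.HasSemisimpleMold.exists_mem_basicOpen`);
hence it has a character with values in `Ch₂(G)_{s.s.}`, and this character only depends on its
equivalence class, because automorphisms of `M₂(R)` preserve traces and determinants
(`algEquiv_trace_det`). A locally bijective map to a sheaf is the sheafification, which gives
`eqSSRepresentableBy`; gluing characters gives `homEquivGenRep`.

`Ch₂(G)_{s.s.}` is separated as an open subscheme of an affine scheme. If `S` generates `G`, then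
the localization of the trace/determinant subring at `m(σ_G(c))` is generated by `1 / m(σ_G(c))`
and the entries of the standard representation at the elements of `S` (`finiteType_away_discCh`),
and the localizations for `c ∈ S` suffice to cover (`chSSOpen_eq_iSup`); this gives the finiteness
statements.
-/

namespace SSMold

/-! ### Matrices of rank at most two -/

/-- The `4 × 3` matrix whose columns are the coordinate vectors of `A`, `B`, `C`. -/
abbrev coords {R : Type*} (A B C : Mat2 R) : Matrix (Fin 2 × Fin 2) (Fin 3) R :=
  Matrix.of fun ij k => (![A, B, C] : Fin 3 → Mat2 R) k ij.1 ij.2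

/-- All `3 × 3` minors of `coords A B C` vanish: `A`, `B`, `C` span a module of rank at most `2`. -/
def MinorsVanish {R : Type*} [CommRing R] (A B C : Mat2 R) : Prop :=
  ∀ r : Fin 3 ↪ Fin 2 × Fin 2, ((coords A B C).submatrix r id).det = 0

/-- The minor on the rows `p`, `q`, `r`, expanded. -/
theorem MinorsVanish.eq_zero {R : Type*} [CommRing R] {A B C : Mat2 R} (h : MinorsVanish A B C)
    (p q r : Fin 2 × Fin 2) (hinj : Function.Injective ![p, q, r]) :
    A p.1 p.2 * B q.1 q.2 * C r.1 r.2 - A p.1 p.2 * C q.1 q.2 * B r.1 r.2 -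
      B p.1 p.2 * A q.1 q.2 * C r.1 r.2 + B p.1 p.2 * C q.1 q.2 * A r.1 r.2 +
      C p.1 p.2 * A q.1 q.2 * B r.1 r.2 - C p.1 p.2 * B q.1 q.2 * A r.1 r.2 = 0 := by
  have h1 := h ⟨![p, q, r], hinj⟩
  rw [Matrix.det_fin_three] at h1
  exact h1

/-- If `1`, `P`, `B` have rank at most `2`, then Cramer's rule expresses `m(P) B` through `1` and
`P`, with coefficients that are polynomials in traces. -/
theorem MinorsVanish.disc_smul_eq {R : Type*} [CommRing R] {P B : Mat2 R}
    (h : MinorsVanish 1 P B) :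
    disc P • B = (B.trace * (P * P).trace - P.trace * (B * P).trace) • (1 : Mat2 R) +
      (2 * (B * P).trace - P.trace * B.trace) • P := by
  have h1 := h.eq_zero (0, 1) (1, 0) (1, 1) (by decide)
  have h2 := h.eq_zero (0, 0) (1, 0) (1, 1) (by decide)
  have h3 := h.eq_zero (0, 0) (0, 1) (1, 1) (by decide)
  have e01 : (1 : Mat2 R) 0 1 = 0 := rfl
  have e10 : (1 : Mat2 R) 1 0 = 0 := rfl
  have e00 : (1 : Mat2 R) 0 0 = 1 := rfl
  have e11 : (1 : Mat2 R) 1 1 = 1 := rfl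
  simp only [e00, e01, e10, e11] at h1 h2 h3
  ext i j
  fin_cases i <;> fin_cases j <;>
    simp [disc, Matrix.trace_fin_two, Matrix.det_fin_two, Matrix.mul_apply, Fin.sum_univ_two]
  · linear_combination (-P 0 1) * h2 - P 1 0 * h3
  · linear_combination (P 0 0 - P 1 1) * h3 - 2 * P 0 1 * h1
  · linear_combination (P 0 0 - P 1 1) * h2 + 2 * P 1 0 * h1
  · linear_combination (P 0 1) * h2 + P 1 0 * h3

/-- If the columns of `V` lie in the kernel of a surjection `a : R⁴ → R²` with section `e`, then the
`3 × 3` minors of `V` vanish. The kernel is only stably free, so instead of a basis of it the proof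
uses a block matrix identity: the minor is the determinant of a `5 × 5` matrix that factors through
`R⁴`. -/
theorem det_submatrix_eq_zero_of_mul_eq_zero {R : Type*} [CommRing R]
    (a : Matrix (Fin 2) (Fin 2 × Fin 2) R) (e : Matrix (Fin 2 × Fin 2) (Fin 2) R)
    (V : Matrix (Fin 2 × Fin 2) (Fin 3) R) (hV : a * V = 0) (he : a * e = 1)
    (r : Fin 3 → Fin 2 × Fin 2) : (V.submatrix r id).det = 0 := by
  let S : Matrix (Fin 3) (Fin 2 × Fin 2) R := (1 : Matrix _ _ R).submatrix r id
  have hS : S * V = V.submatrix r id := by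
    ext i j
    simp [S, Matrix.mul_apply, Matrix.one_apply]
  have key : Matrix.fromBlocks (V.submatrix r id) (S * e) 0 1 =
      Matrix.fromBlocks S (0 : Matrix (Fin 3) (Fin 1) R) a 0 *
        Matrix.fromBlocks V e (0 : Matrix (Fin 1) (Fin 3) R) 0 := by
    rw [Matrix.fromBlocks_multiply]
    simp [hS, hV, he]
  -- `e5` makes both factors square; the column and row indexed by `Fin 1` are zero.
  have e5 : (Fin 2 × Fin 2) ⊕ Fin 1 ≃ Fin 3 ⊕ Fin 2 := Fintype.equivOfCardEq (by simp)
  have := congrArg Matrix.det key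
  rw [Matrix.det_fromBlocks_zero₂₁, Matrix.det_one, mul_one] at this
  rw [this, ← Matrix.submatrix_id_id (Matrix.fromBlocks S (0 : Matrix (Fin 3) (Fin 1) R) a 0 * _),
    Matrix.submatrix_mul _ _ id e5.symm id e5.symm.bijective, Matrix.det_mul]
  rw [Matrix.det_eq_zero_of_column_eq_zero (e5 (Sum.inr 0)), zero_mul]
  intro i
  rcases i with i | i <;> simp

/-- The companion matrix of `T² - t T + D`. -/
def companion {R : Type*} [CommRing R] (t D : R) : Mat2 R := !![0, -D; 1, t]

section

variable {R : Type*} [CommRing R] (t D : R)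

@[simp] theorem companion_zero_zero : companion t D 0 0 = 0 := rfl
@[simp] theorem companion_zero_one : companion t D 0 1 = -D := rfl
@[simp] theorem companion_one_zero : companion t D 1 0 = 1 := rfl
@[simp] theorem companion_one_one : companion t D 1 1 = t := rfl

theorem companion_mul_self :
    companion t D * companion t D = t • companion t D - D • 1 := by
  ext i j
  fin_cases i <;> fin_cases j <;> simp [Matrix.mul_apply, Fin.sum_univ_two, neg_add_eq_sub,
    mul_comm]

end

/-- The matrix with columns `v` and `P v`. -/
def cyclicMatrix {R : Type*} [CommRing R] (P : Mat2 R) (v : Fin 2 → R) : Mat2 R :=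
  !![v 0, P 0 0 * v 0 + P 0 1 * v 1; v 1, P 1 0 * v 0 + P 1 1 * v 1]

/-- The Cayley–Hamilton theorem, in the form `P [v, P v] = [v, P v] C`. -/
theorem mul_cyclicMatrix {R : Type*} [CommRing R] (P : Mat2 R) (v : Fin 2 → R) :
    P * cyclicMatrix P v = cyclicMatrix P v * companion P.trace P.det := by
  ext i j
  fin_cases i <;> fin_cases j <;>
    simp [cyclicMatrix, Matrix.mul_apply, Fin.sum_univ_two, Matrix.trace_fin_two,
      Matrix.det_fin_two] <;> ring

theorem cyclicMatrix_map {R S : Type*} [CommRing R] [CommRing S] (φ : R →+* S) (P : Mat2 R)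
    (v : Fin 2 → R) : φ.mapMatrix (cyclicMatrix P v) = cyclicMatrix (φ.mapMatrix P) (φ ∘ v) := by
  ext i j
  fin_cases i <;> fin_cases j <;> simp [cyclicMatrix]

/-- If `m(P)` is nonzero in `K`, then one of the vectors `(1, 0)`, `(0, 1)`, `(1, 1)` is cyclic for
`P` over `K`. -/
theorem exists_det_cyclicMatrix_ne_zero {R K : Type*} [CommRing R] [CommRing K] (φ : R →+* K)
    (P : Mat2 R) (hP : φ (disc P) ≠ 0) : ∃ v : Fin 2 → R, φ (cyclicMatrix P v).det ≠ 0 := by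
  by_contra! H
  have h1 := H ![1, 0]
  have h2 := H ![0, 1]
  have h3 := H ![1, 1]
  apply hP
  simp [cyclicMatrix, Matrix.det_fin_two] at h1 h2 h3
  simp only [disc, Matrix.trace_fin_two, Matrix.det_fin_two, map_sub, map_pow, map_add, map_mul,
    map_ofNat]
  rw [h1, h2, zero_add, add_zero, sub_eq_zero] at h3
  rw [h1, h2, h3]
  ring

/-- Algebra automorphisms of `M₂(R)` preserve trace and determinant, over any commutative ring `R`.
The Cayley–Hamilton equations of `σ N` and of `N` differ by a linear relation between `N` and `1`,
which on the matrix units forces the traces to agree. -/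
theorem algEquiv_trace_det {R : Type*} [CommRing R] (σ : Mat2 R ≃ₐ[R] Mat2 R) (M : Mat2 R) :
    (σ M).trace = M.trace ∧ (σ M).det = M.det := by
  have ch : ∀ N : Mat2 R, N * N = N.trace • N - N.det • 1 := by
    intro N
    ext i j
    fin_cases i <;> fin_cases j <;>
      simp [Matrix.mul_apply, Fin.sum_univ_two, Matrix.trace_fin_two, Matrix.det_fin_two] <;> ring
  have key : ∀ N : Mat2 R, ((σ N).trace - N.trace) • N = ((σ N).det - N.det) • 1 := by
    intro N
    apply σ.injective
    have h1 := congrArg σ (ch N)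
    rw [map_mul, ch] at h1
    simp only [map_sub, map_smul, map_one] at h1 ⊢
    rw [sub_smul, sub_smul]
    rw [sub_eq_sub_iff_add_eq_add] at h1 ⊢
    exact h1.trans (add_comm _ _)
  have hs : ∀ i j, (σ (Matrix.single i j 1)).trace = (Matrix.single i j (1 : R)).trace := by
    intro i j
    have h := key (Matrix.single i j 1)
    have e00 := congrFun (congrFun h 0) 0
    have e01 := congrFun (congrFun h 0) 1
    have e10 := congrFun (congrFun h 1) 0
    have e11 := congrFun (congrFun h 1) 1
    rw [← sub_eq_zero]
    fin_cases i <;> fin_cases j <;> simp at e00 e01 e10 e11 ⊢ <;>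
      simp_all
  have ht : (σ M).trace = M.trace := by
    have : (Matrix.traceLinearMap (Fin 2) R R) ∘ₗ σ.toLinearMap =
        Matrix.traceLinearMap (Fin 2) R R := by
      apply Matrix.ext_linearMap
      intro i j
      ext
      simpa using hs i j
    exact LinearMap.congr_fun this M
  refine ⟨ht, ?_⟩
  have h := congrFun (congrFun (key M) 0) 0
  rw [ht] at h
  rw [sub_self, zero_smul] at h
  simpa [sub_eq_zero] using h.symm

section coefficients

variable {R : Type*} [CommRing R]

/-- The coefficient of `1` in `m(P) B = X • 1 + Y • P`. -/
def coefX (P B : Mat2 R) : R := B.trace * (P * P).trace - P.trace * (B * P).trace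

/-- The coefficient of `P` in `m(P) B = X • 1 + Y • P`. -/
def coefY (P B : Mat2 R) : R := 2 * (B * P).trace - P.trace * B.trace

theorem coefY_self {R : Type*} [CommRing R] (P : Mat2 R) : coefY P P = disc P := by
  simp [coefY, disc, Matrix.trace_fin_two, Matrix.det_fin_two, Matrix.mul_apply, Fin.sum_univ_two]
  ring

/-- Multiplicativity of `B ↦ (X • 1 + Y • P) / m(P)`, where `P² = tr(P) P - det(P)`. Only `B'` has
to be dependent on `1` and `P`. -/
theorem MinorsVanish.disc_mul_coef {P B' : Mat2 R} (h : MinorsVanish 1 P B') (B : Mat2 R) :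
    disc P * coefX P (B * B') = coefX P B * coefX P B' - coefY P B * coefY P B' * P.det ∧
    disc P * coefY P (B * B') =
      coefX P B * coefY P B' + coefY P B * coefX P B' + coefY P B * coefY P B' * P.trace := by
  have hB : disc P • B' = coefX P B' • (1 : Mat2 R) + coefY P B' • P := h.disc_smul_eq
  have h1 : disc P * (B * B').trace = coefX P B' * B.trace + coefY P B' * (B * P).trace := by
    have := congrArg (fun M => (B * M).trace) hB
    simpa [mul_add, Matrix.trace_add, Matrix.trace_smul] using this
  have h2 : disc P * (B * B' * P).trace =
      coefX P B' * (B * P).trace + coefY P B' * (B * P * P).trace := by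
    have := congrArg (fun M => (B * M * P).trace) hB
    simpa [mul_add, add_mul, Matrix.trace_add, Matrix.trace_smul] using this
  have h3 : (B * P * P).trace = P.trace * (B * P).trace - P.det * B.trace := by
    simp [Matrix.trace_fin_two, Matrix.det_fin_two, Matrix.mul_apply, Fin.sum_univ_two]
    ring
  have h4 : (P * P).trace = P.trace ^ 2 - 2 * P.det := by
    simp [Matrix.trace_fin_two, Matrix.det_fin_two, Matrix.mul_apply, Fin.sum_univ_two]
    ring
  rw [h3] at h2
  have hX : coefX P B = B.trace * (P * P).trace - P.trace * (B * P).trace := rfl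
  have hY : coefY P B = 2 * (B * P).trace - P.trace * B.trace := rfl
  constructor
  · rw [coefX]
    linear_combination (P * P).trace * h1 - P.trace * h2 - coefX P B' * hX +
      coefY P B' * P.det * hY + coefY P B' * (B * P).trace * h4
  · rw [coefY]
    linear_combination 2 * h2 - P.trace * h1 - coefY P B' * hX -
      (coefX P B' + coefY P B' * P.trace) * hY - coefY P B' * B.trace * h4

theorem trace_coef (P B : Mat2 R) :
    2 * coefX P B + coefY P B * P.trace = disc P * B.trace := by
  simp [coefX, coefY, disc, Matrix.trace_fin_two, Matrix.det_fin_two, Matrix.mul_apply,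
    Fin.sum_univ_two]
  ring

theorem MinorsVanish.det_coef {P B : Mat2 R} (h : MinorsVanish 1 P B) :
    coefX P B ^ 2 + coefX P B * coefY P B * P.trace + coefY P B ^ 2 * P.det =
      disc P ^ 2 * B.det := by
  have hB : disc P • B = coefX P B • (1 : Mat2 R) + coefY P B • P := h.disc_smul_eq
  have := congrArg Matrix.det hB
  rw [Matrix.det_smul] at this
  simp only [Fintype.card_fin] at this
  rw [this]
  simp [Matrix.trace_fin_two, Matrix.det_fin_two]
  ring

/-- The discriminant scales by `y²` under `P ↦ x + y P`, here with `y = Y / m(P)`. -/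
theorem MinorsVanish.disc_mul_disc {P B : Mat2 R} (h : MinorsVanish 1 P B) :
    disc P ^ 2 * disc B = coefY P B ^ 2 * disc P := by
  have h1 := trace_coef P B
  have h2 := h.det_coef
  have h3 : disc P = P.trace ^ 2 - 4 * P.det := rfl
  have h4 : disc B = B.trace ^ 2 - 4 * B.det := rfl
  linear_combination disc P ^ 2 * h4 - (disc P * B.trace + 2 * coefX P B + coefY P B * P.trace) * h1
    + 4 * h2 - coefY P B ^ 2 * h3

end coefficients

/-! ### Identities between traces over the universal ring -/

section universal

variable {G : Type u} [Monoid G]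

theorem univRepRk_minorsVanish (a b c : G) :
    MinorsVanish (univRepRk G a) (univRepRk G b) (univRepRk G c) := by
  intro r
  have h : (Ideal.Quotient.mk (minorIdeal G)) ((coordMatrix a b c).submatrix r id).det = 0 :=
    Ideal.Quotient.eq_zero_iff_mem.mpr (Ideal.subset_span ⟨a, b, c, r, rfl⟩)
  refine Eq.trans ?_ ((RingHom.map_det _ _).symm.trans h)
  congr 1
  ext i j
  fin_cases j <;> rfl

/-- `m(σ_G(c))` as an element of the trace/determinant subring. -/
noncomputable def discCh (c : G) : A2rkCh G := trCh c ^ 2 - 4 * detCh c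

/-- The coefficient of `1` in `m(σ_G(c)) σ_G(g) = X • 1 + Y • σ_G(c)`, as an element of the
trace/determinant subring. -/
noncomputable def chX (c g : G) : A2rkCh G := trCh g * trCh (c * c) - trCh c * trCh (g * c)

/-- The coefficient of `σ_G(c)` in `m(σ_G(c)) σ_G(g) = X • 1 + Y • σ_G(c)`, as an element of the
trace/determinant subring. -/
noncomputable def chY (c g : G) : A2rkCh G := 2 * trCh (g * c) - trCh c * trCh g

theorem coe_discCh (c : G) : (discCh c : A2rk G) = disc (univRepRk G c) := rfl

theorem coe_chX (c g : G) : (chX c g : A2rk G) = coefX (univRepRk G c) (univRepRk G g) := by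
  change (univRepRk G g).trace * (univRepRk G (c * c)).trace -
    (univRepRk G c).trace * (univRepRk G (g * c)).trace = _
  rw [map_mul, map_mul]; rfl

theorem coe_chY (c g : G) : (chY c g : A2rk G) = coefY (univRepRk G c) (univRepRk G g) := by
  change 2 * (univRepRk G (g * c)).trace - (univRepRk G c).trace * (univRepRk G g).trace = _
  rw [map_mul]; rfl

theorem univRepRk_minorsVanish_one (c g : G) :
    MinorsVanish 1 (univRepRk G c) (univRepRk G g) := by
  rw [← map_one (univRepRk G)]
  exact univRepRk_minorsVanish 1 c g

theorem discCh_mul_chX (c g h : G) :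
    discCh c * chX c (g * h) = chX c g * chX c h - chY c g * chY c h * detCh c := by
  apply Subtype.ext
  push_cast
  rw [coe_discCh, coe_chX, coe_chX, coe_chX, coe_chY, coe_chY, map_mul]
  exact ((univRepRk_minorsVanish_one c h).disc_mul_coef _).1

theorem discCh_mul_chY (c g h : G) :
    discCh c * chY c (g * h) =
      chX c g * chY c h + chY c g * chX c h + chY c g * chY c h * trCh c := by
  apply Subtype.ext
  push_cast
  rw [coe_discCh, coe_chX, coe_chX, coe_chY, coe_chY, coe_chY, map_mul]
  exact ((univRepRk_minorsVanish_one c h).disc_mul_coef _).2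

theorem two_chX_add (c g : G) :
    2 * chX c g + chY c g * trCh c = discCh c * trCh g := by
  apply Subtype.ext
  push_cast
  rw [coe_discCh, coe_chX, coe_chY]
  exact trace_coef _ _

theorem chX_sq_add (c g : G) :
    chX c g ^ 2 + chX c g * chY c g * trCh c + chY c g ^ 2 * detCh c =
      discCh c ^ 2 * detCh g := by
  apply Subtype.ext
  push_cast
  rw [coe_discCh, coe_chX, coe_chY]
  exact (univRepRk_minorsVanish_one c g).det_coef

theorem discCh_sq_mul (c g : G) : discCh c ^ 2 * discCh g = chY c g ^ 2 * discCh c := by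
  apply Subtype.ext
  push_cast
  rw [coe_discCh, coe_discCh, coe_chY]
  exact (univRepRk_minorsVanish_one c g).disc_mul_disc

theorem trace_one_eq_two {R : Type*} [CommRing R] : (1 : Mat2 R).trace = 2 := by
  simp

theorem map_trace_det {R S : Type*} [CommRing R] [CommRing S] (φ : R →+* S) (M : Mat2 R) :
    φ M.trace = (φ.mapMatrix M).trace ∧ φ M.det = (φ.mapMatrix M).det :=
  ⟨AddMonoidHom.map_trace φ M, RingHom.map_det φ M⟩

theorem trCh_one : trCh (1 : G) = 2 := by
  apply Subtype.ext
  change (univRepRk G 1).trace = 2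
  rw [map_one]
  exact trace_one_eq_two (R := A2rk G)

theorem trCh_mul_self (c : G) : trCh (c * c) = trCh c ^ 2 - 2 * detCh c := by
  apply Subtype.ext
  change (univRepRk G (c * c)).trace = (univRepRk G c).trace ^ 2 - 2 * (univRepRk G c).det
  rw [map_mul]
  simp only [Matrix.trace_fin_two, Matrix.det_fin_two, Matrix.mul_apply, Fin.sum_univ_two]
  ring

theorem chX_one (c : G) : chX c 1 = discCh c := by
  rw [chX, discCh, trCh_one, one_mul, trCh_mul_self]; ring

theorem chY_one (c : G) : chY c 1 = 0 := by
  rw [chY, trCh_one, one_mul]; ring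

theorem chX_self (c : G) : chX c c = 0 := by
  rw [chX]; ring

theorem chY_self (c : G) : chY c c = discCh c := by
  rw [chY, discCh, trCh_mul_self]; ring

theorem closure_trCh_detCh :
    Subring.closure (Set.range (trCh (G := G)) ∪ Set.range (detCh (G := G))) = ⊤ := by
  refine eq_top_iff.mpr fun x _ => ?_
  have h : (Subring.closure (Set.range (trCh (G := G)) ∪ Set.range (detCh (G := G)))).map
      (A2rkCh G).subtype = A2rkCh G := by
    rw [RingHom.map_closure, Set.image_union, ← Set.range_comp, ← Set.range_comp]
    rfl
  obtain ⟨y, hy, hyx⟩ := h.ge x.2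
  rwa [← (Subtype.ext hyx : y = x)]

theorem A2rkCh_hom_ext {R : Type*} [CommRing R] {φ ψ : A2rkCh G →+* R}
    (ht : ∀ g, φ (trCh g) = ψ (trCh g)) (hd : ∀ g, φ (detCh g) = ψ (detCh g)) : φ = ψ := by
  refine RingHom.eq_of_eqOn_set_dense closure_trCh_detCh ?_
  rintro _ (⟨g, rfl⟩ | ⟨g, rfl⟩)
  exacts [ht g, hd g]

/-- A representation of rank at most `2` over `R` defines its character, the ring homomorphism from
the trace/determinant subring to `R` given by its traces and determinants. -/
theorem exists_charHom {R : Type*} [CommRing R] (ρ : G →* Mat2 R)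
    (h : ∀ a b c, MinorsVanish (ρ a) (ρ b) (ρ c)) :
    ∃ φ : A2rkCh G →+* R, ∀ g, φ (trCh g) = (ρ g).trace ∧ φ (detCh g) = (ρ g).det := by
  obtain ⟨ψ, hψ, -⟩ := existsUnique_A2_lift G ρ
  have hker : ∀ x ∈ minorIdeal G, ψ x = 0 := by
    intro x hx
    have hle : minorIdeal G ≤ RingHom.ker ψ := by
      refine Ideal.span_le.mpr ?_
      rintro _ ⟨a, b, c, r, rfl⟩
      change ψ _ = 0
      rw [← h a b c r, RingHom.map_det, ← hψ, ← hψ, ← hψ]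
      congr 1
      ext i j
      fin_cases j <;> rfl
    exact hle hx
  let χ : A2rk G →+* R := Ideal.Quotient.lift _ ψ hker
  have hχ : ∀ g, χ.mapMatrix (univRepRk G g) = ρ g := by
    intro g
    rw [← hψ]
    ext i j
    rfl
  refine ⟨χ.comp (A2rkCh G).subtype, fun g => ?_⟩
  rw [← hχ]
  exact map_trace_det χ (univRepRk G g)

end universal

/-! ### The standard representation with a given character -/

section standard

variable {G : Type u} [Monoid G] {R : Type*} [CommRing R] (φ : A2rkCh G →+* R) (c : G)
  (hc : IsUnit (φ (discCh c)))

/-- The standard representation with character `φ`, where `φ(m(σ_G(c)))` is a unit: the universal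
formula for `σ_G(g)` in terms of `1` and `σ_G(c)`, with `σ_G(c)` replaced by a companion matrix. -/
noncomputable def stdRep : G →* Mat2 R where
  toFun g := (↑hc.unit⁻¹ : R) •
    (φ (chX c g) • (1 : Mat2 R) + φ (chY c g) • companion (φ (trCh c)) (φ (detCh c)))
  map_one' := by
    rw [chX_one, chY_one, map_zero, zero_smul, add_zero, smul_smul, IsUnit.val_inv_mul, one_smul]
  map_mul' g h := by
    have hu : (↑hc.unit⁻¹ : R) * φ (discCh c) = 1 := hc.val_inv_mul
    generalize (↑hc.unit⁻¹ : R) = u at hu ⊢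
    have h1 := congrArg φ (discCh_mul_chX c g h)
    have h2 := congrArg φ (discCh_mul_chY c g h)
    simp only [map_mul, map_sub, map_add] at h1 h2
    have h1' : u * φ (chX c (g * h)) = u ^ 2 * (φ (chX c g) * φ (chX c h) -
        φ (chY c g) * φ (chY c h) * φ (detCh c)) := by
      rw [← h1]; linear_combination (-u * φ (chX c (g * h))) * hu
    have h2' : u * φ (chY c (g * h)) = u ^ 2 * (φ (chX c g) * φ (chY c h) +
        φ (chY c g) * φ (chX c h) + φ (chY c g) * φ (chY c h) * φ (trCh c)) := by
      rw [← h2]; linear_combination (-u * φ (chY c (g * h))) * hu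
    have hC := companion_mul_self (φ (trCh c)) (φ (detCh c))
    generalize companion (φ (trCh c)) (φ (detCh c)) = C at hC ⊢
    rw [smul_add, smul_smul, smul_smul, h1', h2']
    simp only [smul_add, add_mul, mul_add, smul_mul_assoc, mul_smul_comm, one_mul, mul_one, hC,
      smul_sub, smul_smul]
    module

theorem stdRep_apply (g : G) : φ (discCh c) • stdRep φ c hc g =
    φ (chX c g) • (1 : Mat2 R) + φ (chY c g) • companion (φ (trCh c)) (φ (detCh c)) := by
  change φ (discCh c) • ((↑hc.unit⁻¹ : R) • (_ : Mat2 R)) = _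
  rw [smul_smul, IsUnit.mul_val_inv, one_smul]

theorem stdRep_self : stdRep φ c hc c = companion (φ (trCh c)) (φ (detCh c)) := by
  change (↑hc.unit⁻¹ : R) • (_ : Mat2 R) = _
  rw [chX_self, chY_self, map_zero, zero_smul, zero_add, smul_smul, IsUnit.val_inv_mul, one_smul]

theorem trace_companion (t D : R) : (companion t D).trace = t := by
  simp [Matrix.trace_fin_two]

theorem det_companion (t D : R) : (companion t D).det = D := by
  simp [Matrix.det_fin_two]

theorem trace_stdRep (g : G) : (stdRep φ c hc g).trace = φ (trCh g) := by
  have h := congrArg Matrix.trace (stdRep_apply φ c hc g)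
  have h2 := congrArg φ (two_chX_add c g)
  simp only [map_mul, map_add, map_ofNat] at h2
  rw [Matrix.trace_smul, Matrix.trace_add, Matrix.trace_smul, Matrix.trace_smul, trace_companion,
    Matrix.trace_one, Fintype.card_fin, smul_eq_mul, smul_eq_mul, smul_eq_mul] at h
  refine hc.mul_left_cancel (h.trans ?_)
  rw [← h2]; push_cast; ring

theorem det_stdRep (g : G) : (stdRep φ c hc g).det = φ (detCh g) := by
  have h := congrArg Matrix.det (stdRep_apply φ c hc g)
  have h2 := congrArg φ (chX_sq_add c g)
  simp only [map_mul, map_add, map_pow] at h2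
  rw [Matrix.det_smul, Fintype.card_fin] at h
  refine (hc.pow 2).mul_left_cancel (h.trans ?_)
  rw [← h2]
  simp [Matrix.det_fin_two]
  ring

/-- A matrix `Q` that carries the companion matrix to `ρ(c)` intertwines the standard representation
with `ρ`. -/
theorem mul_eq_mul_stdRep (ρ : G →* Mat2 R) (hmin : ∀ g, MinorsVanish 1 (ρ c) (ρ g))
    (ht : ∀ g, φ (trCh g) = (ρ g).trace) (hd : φ (detCh c) = (ρ c).det) (Q : Mat2 R)
    (hQ : ρ c * Q = Q * companion (ρ c).trace (ρ c).det) (g : G) :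
    ρ g * Q = Q * stdRep φ c hc g := by
  have hdisc : φ (discCh c) = disc (ρ c) := by
    simp [discCh, disc, ht, hd, map_ofNat φ 4]
  have h1 := (hmin g).disc_smul_eq
  have hX : φ (chX c g) =
      (ρ g).trace * (ρ c * ρ c).trace - (ρ c).trace * (ρ g * ρ c).trace := by
    simp [chX, ht]
  have hY : φ (chY c g) = 2 * (ρ g * ρ c).trace - (ρ c).trace * (ρ g).trace := by
    simp [chY, ht, map_ofNat φ 2]
  rw [← hX, ← hY, ← hdisc] at h1
  have h2 : φ (discCh c) • (ρ g * Q) = φ (discCh c) • (Q * stdRep φ c hc g) := by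
    rw [← smul_mul_assoc, ← mul_smul_comm, stdRep_apply, h1, ht, hd, add_mul, mul_add,
      smul_mul_assoc, smul_mul_assoc, mul_smul_comm, mul_smul_comm, hQ, one_mul, mul_one]
  exact hc.smul_left_cancel.mp h2

end standard

/-! ### Representations with semi-simple mold -/

theorem minorsVanish_of_functional_eq_zero {R : Type*} [CommRing R] (a : Fin 2 → Fin 2 → Fin 2 → R)
    (e : Fin 2 → Mat2 R) (hae : ∀ i j, functional (a i) (e j) = if i = j then 1 else 0)
    {A B C : Mat2 R} (hA : ∀ i, functional (a i) A = 0) (hB : ∀ i, functional (a i) B = 0)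
    (hC : ∀ i, functional (a i) C = 0) : MinorsVanish A B C := by
  intro r
  have hf : ∀ i (M : Mat2 R),
      ∑ p : Fin 2 × Fin 2, a i p.1 p.2 * M p.1 p.2 = functional (a i) M := by
    intro i M
    simp only [Fintype.sum_prod_type, functional, LinearMap.coe_mk, AddHom.coe_mk, mul_comm]
  refine det_submatrix_eq_zero_of_mul_eq_zero (Matrix.of fun i p => a i p.1 p.2)
    (Matrix.of fun p j => e j p.1 p.2) (coords A B C) ?_ ?_ r
  · ext i k
    fin_cases k
    · exact (hf i A).trans (hA i)
    · exact (hf i B).trans (hB i)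
    · exact (hf i C).trans (hC i)
  · ext i j
    exact (hf i (e j)).trans ((hae i j).trans (Matrix.one_apply).symm)

section molds

variable {G : Type u} [Monoid G] {X : Scheme.{u}}

/-- Sections of a rank `2` mold `𝒪_X[ρ(G)]` have rank at most `2`: near each point they are killed
by the two coordinate functionals of a frame of the quotient. -/
theorem Rep2.exists_minorsVanish (ρ : Rep2 G X) (h : ρ.generated.IsRankTwoMold) (x : X) :
    ∃ U : X.Opens, x ∈ U ∧ ∀ V ≤ U, ∀ A ∈ ρ.generated.sections V, ∀ B ∈ ρ.generated.sections V,
      ∀ C ∈ ρ.generated.sections V, MinorsVanish A B C := by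
  obtain ⟨U, hxU, e, he⟩ := h x
  have heU : ∀ M : Mat2 Γ(X, U), ∃! c : Fin 2 → Γ(X, U),
      M - ∑ i, c i • e i ∈ ρ.generated.sections U := by
    intro M
    have := he U le_rfl M
    simpa only [res_refl] using this
  choose c hc hcu using heU
  let a : Fin 2 → Fin 2 → Fin 2 → Γ(X, U) := fun i p q => c (Matrix.single p q 1) i
  have ha : ∀ M i, c M i = functional (a i) M := by
    intro M i
    have : c M = fun i => functional (a i) M := by
      refine (hcu M _ ?_).symm
      beta_reduce
      rw [sub_functional_eq a e M]
      exact sum_mem fun p _ => sum_mem fun q _ =>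
        Subalgebra.smul_mem _ (hc (Matrix.single p q 1)) _
    exact congrFun this i
  have hzero : ∀ M ∈ ρ.generated.sections U, ∀ i, functional (a i) M = 0 := by
    intro M hM i
    have h1 : c M = 0 := (hcu _ 0 (by simpa using hM)).symm
    rw [← ha, h1, Pi.zero_apply]
  have hdual : ∀ i j, functional (a i) (e j) = if i = j then 1 else 0 := by
    intro i j
    have h1 : c (e j) = fun i => if i = j then 1 else 0 := (hcu _ _ (by simp)).symm
    rw [← ha, h1]
  refine ⟨U, hxU, fun V hV A hA B hB C hC => ?_⟩
  have hzeroV : ∀ M ∈ ρ.generated.sections V, ∀ i,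
      functional (fun p q => res hV (a i p q)) M = 0 := by
    intro M hM i
    refine ρ.functional_eq_zero _ (fun g => ?_) hM
    rw [← res_onOpen ρ hV, functional_map, hzero _ (ρ.onOpen_mem_generated U g), map_zero]
  refine minorsVanish_of_functional_eq_zero (fun i p q => res hV (a i p q))
    (fun j => (res hV).mapMatrix (e j)) (fun i j => ?_) (hzeroV A hA) (hzeroV B hB) (hzeroV C hC)
  rw [functional_map, hdual]
  split_ifs <;> simp

theorem Rep2.onOpen_top (ρ : Rep2 G X) (g : G) : ρ.onOpen ⊤ g = ρ g := res_refl _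

theorem Rep2.minorsVanish (ρ : Rep2 G X) (h : ρ.generated.IsRankTwoMold) (a b c : G) :
    MinorsVanish (ρ a) (ρ b) (ρ c) := by
  intro r
  refine TopCat.Presheaf.section_ext X.sheaf ⊤ _ _ fun x _ => ?_
  obtain ⟨U, hxU, hU⟩ := ρ.exists_minorsVanish h x
  have h0 := hU U le_rfl _ (ρ.onOpen_mem_generated U a) _ (ρ.onOpen_mem_generated U b) _
    (ρ.onOpen_mem_generated U c) r
  have h1 : res (le_top : U ≤ ⊤) ((coords (ρ a) (ρ b) (ρ c)).submatrix r id).det = 0 := by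
    rw [← h0]
    refine (RingHom.map_det _ _).trans ?_
    congr 1
    ext i j
    fin_cases j <;> rfl
  have h2 := X.presheaf.germ_res_apply (homOfLE (le_top : U ≤ ⊤)) x hxU
    ((coords (ρ a) (ρ b) (ρ c)).submatrix r id).det
  have h3 := X.presheaf.germ_res_apply (homOfLE (le_top : U ≤ ⊤)) x hxU (0 : Γ(X, ⊤))
  rw [map_zero] at h3
  exact (h2.symm.trans (congrArg _ h1)).trans h3

/-- The section `P` of the mold with `m(P)(x) ≠ 0` may be taken of the form `ρ(g)`. If all
`m(ρ(g))` vanish at `x`, then so does the coefficient `Y(ρ(g))` of `P` in `m(P) ρ(g)`. As `Y` is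
linear and the `ρ(g)` span the mold, `Y(P) = m(P)` vanishes at `x` as well. -/
theorem Rep2.HasSemisimpleMold.exists_mem_basicOpen {ρ : Rep2 G X} (h : ρ.HasSemisimpleMold)
    (x : X) : ∃ g, x ∈ X.basicOpen (disc (ρ g)) := by
  obtain ⟨U, hxU, hU⟩ := ρ.exists_minorsVanish h.1 x
  obtain ⟨U', hxU', P, hP, hne⟩ := h.2 x
  erw [Scheme.evaluation_ne_zero_iff_mem_basicOpen] at hne
  obtain ⟨W, hW, hxW, hPW⟩ := hP x hxU'
  let V : X.Opens := U ⊓ W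
  have hVU : V ≤ U := inf_le_left
  have hVW : V ≤ W := inf_le_right
  have hxV : x ∈ V := ⟨hxU, hxW⟩
  set Q : Mat2 Γ(X, V) := (res (hVW.trans hW)).mapMatrix P with hQ
  have hQV : Q ∈ Algebra.adjoin Γ(X, V) (Set.range (ρ.onOpen V)) := by
    rw [hQ, ← res_res hVW hW]
    exact mapMatrix_mem_adjoin _ _ _ (res_onOpen ρ _) hPW
  have hmin : ∀ g, MinorsVanish 1 Q (ρ.onOpen V g) := fun g =>
    hU V hVU 1 (one_mem _) Q (ρ.generated.res_mem _ hP) _ (ρ.onOpen_mem_generated V g)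
  have hxQ : x ∈ X.basicOpen (disc Q) := by
    rw [hQ, disc_map, Scheme.basicOpen_res]
    exact ⟨hxV, hne⟩
  let ev : Γ(X, V) →+* X.residueField x := (X.evaluation V x hxV).hom
  have hev : ∀ f, ev f ≠ 0 ↔ x ∈ X.basicOpen f := fun f =>
    Scheme.evaluation_ne_zero_iff_mem_basicOpen X x hxV f
  have hevQ : ev (disc Q) ≠ 0 := (hev _).mpr hxQ
  suffices hg : ∃ g, ev (disc (ρ.onOpen V g)) ≠ 0 by
    obtain ⟨g, hg⟩ := hg
    rw [hev, Rep2.onOpen, disc_map, Scheme.basicOpen_res] at hg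
    exact ⟨g, hg.2⟩
  by_contra! hall
  have hY : ∀ g, ev (coefY Q (ρ.onOpen V g)) = 0 := by
    intro g
    have h1 := congrArg ev (hmin g).disc_mul_disc
    rw [map_mul, map_mul, hall, mul_zero, map_pow] at h1
    simpa [hevQ] using h1.symm
  rw [← Subalgebra.mem_toSubmodule, ρ.adjoin_onOpen] at hQV
  refine hevQ ?_
  rw [← coefY_self]
  suffices hspan : ∀ M ∈ Submodule.span Γ(X, V) (Set.range (ρ.onOpen V)), ev (coefY Q M) = 0 from
    hspan Q hQV
  intro M hM
  induction hM using Submodule.span_induction with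
  | mem M hM =>
    obtain ⟨g, rfl⟩ := hM
    exact hY g
  | zero => simp [coefY]
  | add M N _ _ h1 h2 =>
    have : coefY Q (M + N) = coefY Q M + coefY Q N := by
      simp only [coefY, add_mul, Matrix.trace_add]; ring
    rw [this, map_add, h1, h2, add_zero]
  | smul r M _ h1 =>
    have : coefY Q (r • M) = r * coefY Q M := by
      simp only [coefY, smul_mul_assoc, Matrix.trace_smul, smul_eq_mul]; ring
    rw [this, map_mul, h1, mul_zero]

/-- If `ρ(c)` is a companion matrix with invertible discriminant and all `ρ(g)` are combinations
of `1` and `ρ(c)`, then `ρ` has semi-simple mold: a matrix lies in `𝒪_X[ρ(G)]` if and only if its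
second column is determined by its first in the way that it is for `1` and `ρ(c)`. -/
theorem Rep2.hasSemisimpleMold_of_companion (ρ : Rep2 G X) (c : G) (t D : Γ(X, ⊤))
    (hc : ρ c = companion t D) (hρ : ∀ g, ∃ a b : Γ(X, ⊤), ρ g = a • (1 : Mat2 Γ(X, ⊤)) + b • ρ c)
    (hu : IsUnit (disc (ρ c))) : ρ.HasSemisimpleMold := by
  have hmem : ∀ (V : X.Opens) (M : Mat2 Γ(X, V)), M ∈ ρ.generated.sections V ↔
      M 0 1 = - res (le_top : V ≤ ⊤) D * M 1 0 ∧
        M 1 1 = M 0 0 + res (le_top : V ≤ ⊤) t * M 1 0 := by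
    intro V M
    set D' := res (le_top : V ≤ ⊤) D
    set t' := res (le_top : V ≤ ⊤) t
    have hcV : ρ.onOpen V c = companion t' D' := by
      rw [Rep2.onOpen, hc]
      ext i j
      fin_cases i <;> fin_cases j <;> simp [D', t']
    constructor
    · intro hM
      have hρV : ∀ g, ∃ a b : Γ(X, V),
          ρ.onOpen V g = a • (1 : Mat2 Γ(X, V)) + b • companion t' D' := by
        intro g
        obtain ⟨a, b, hab⟩ := hρ g
        refine ⟨res le_top a, res le_top b, ?_⟩
        rw [← hcV, Rep2.onOpen, Rep2.onOpen, hab]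
        ext i j
        simp [Matrix.one_apply, apply_ite (res (le_top : V ≤ ⊤))]
      have h1 := ρ.functional_eq_zero ![![0, 1], ![D', 0]] (fun g => by
        obtain ⟨a, b, hab⟩ := hρV g
        rw [hab]
        simp [functional, Fin.sum_univ_two]) hM
      have h2 := ρ.functional_eq_zero ![![-1, 0], ![-t', 1]] (fun g => by
        obtain ⟨a, b, hab⟩ := hρV g
        rw [hab]
        simp [functional, Fin.sum_univ_two]) hM
      simp [functional, Fin.sum_univ_two] at h1 h2
      exact ⟨by linear_combination h1, by linear_combination h2⟩
    · rintro ⟨h1, h2⟩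
      have : M = M 0 0 • (1 : Mat2 Γ(X, V)) + M 1 0 • ρ.onOpen V c := by
        rw [hcV]
        ext i j
        fin_cases i <;> fin_cases j <;> simp [h1, h2, mul_comm]
      rw [this]
      exact add_mem (Subalgebra.smul_mem _ (one_mem _) _)
        (Subalgebra.smul_mem _ (ρ.onOpen_mem_generated V c) _)
  refine ⟨fun x => ⟨⊤, trivial, ![Matrix.single 0 1 1, Matrix.single 1 1 1], fun V h M => ?_⟩,
    fun x => ⟨⊤, trivial, ρ c, ?_, ?_⟩⟩
  · refine ⟨![M 0 1 + res h D * M 1 0, M 1 1 - M 0 0 - res h t * M 1 0], ?_, ?_⟩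
    · beta_reduce
      rw [hmem]
      simp [Fin.sum_univ_two]
      ring
    · intro d hd
      rw [hmem] at hd
      simp [Fin.sum_univ_two] at hd
      ext i
      fin_cases i
      · simp
        linear_combination -hd.1
      · simp
        linear_combination -hd.2
  · rw [← ρ.onOpen_top]
    exact ρ.onOpen_mem_generated ⊤ c
  · erw [Scheme.evaluation_ne_zero_iff_mem_basicOpen]
    rw [Scheme.basicOpen_of_isUnit _ hu]
    trivial

end molds

/-! ### Local conjugacy of representations with the same character -/

section conjugacy

variable {G : Type u} [Monoid G] {X Y : Scheme.{u}}

/-- Two representations with the same character, each with a cyclic vector for the image of `c`, are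
both conjugate to the standard representation. -/
theorem exists_conj_of_cyclic {R : Type*} [CommRing R] (ρ ρ' : G →* Mat2 R)
    (h : ∀ a b c, MinorsVanish (ρ a) (ρ b) (ρ c)) (h' : ∀ a b c, MinorsVanish (ρ' a) (ρ' b) (ρ' c))
    (ht : ∀ g, (ρ g).trace = (ρ' g).trace) (hd : ∀ g, (ρ g).det = (ρ' g).det) (c : G)
    (hc : IsUnit (disc (ρ c))) (v v' : Fin 2 → R) (hv : IsUnit (cyclicMatrix (ρ c) v).det)
    (hv' : IsUnit (cyclicMatrix (ρ' c) v').det) :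
    ∃ P : GL (Fin 2) R, ∀ g, (↑P⁻¹ : Mat2 R) * ρ g * P.1 = ρ' g := by
  obtain ⟨φ, hφ⟩ := exists_charHom ρ h
  have hφc : φ (discCh c) = disc (ρ c) := by
    simp [discCh, disc, hφ, map_ofNat φ 4]
  rw [← hφc] at hc
  let Q : GL (Fin 2) R := Matrix.GeneralLinearGroup.mk'' _ hv
  let Q' : GL (Fin 2) R := Matrix.GeneralLinearGroup.mk'' _ hv'
  have hQ : ∀ g, ρ g * Q.1 = Q.1 * stdRep φ c hc g :=
    mul_eq_mul_stdRep φ c hc ρ (fun g => by rw [← map_one ρ]; exact h 1 c g) (fun g => (hφ g).1)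
      (hφ c).2 _ (mul_cyclicMatrix _ _)
  have hQ' : ∀ g, ρ' g * Q'.1 = Q'.1 * stdRep φ c hc g :=
    mul_eq_mul_stdRep φ c hc ρ' (fun g => by rw [← map_one ρ']; exact h' 1 c g)
      (fun g => (hφ g).1.trans (ht g)) ((hφ c).2.trans (hd c)) _ (mul_cyclicMatrix _ _)
  refine ⟨Q * Q'⁻¹, fun g => ?_⟩
  rw [mul_inv_rev, inv_inv]
  change Q'.1 * (↑Q⁻¹ : Mat2 R) * ρ g * (Q.1 * (↑Q'⁻¹ : Mat2 R)) = ρ' g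
  have e1 : (↑Q⁻¹ : Mat2 R) * Q.1 = 1 := Q.inv_mul
  have e2 : Q'.1 * (↑Q'⁻¹ : Mat2 R) = 1 := Q'.mul_inv
  calc Q'.1 * (↑Q⁻¹ : Mat2 R) * ρ g * (Q.1 * (↑Q'⁻¹ : Mat2 R))
      = Q'.1 * (↑Q⁻¹ : Mat2 R) * (ρ g * Q.1) * (↑Q'⁻¹ : Mat2 R) := by simp only [mul_assoc]
    _ = Q'.1 * ((↑Q⁻¹ : Mat2 R) * Q.1) * stdRep φ c hc g * (↑Q'⁻¹ : Mat2 R) := by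
        rw [hQ]; simp only [mul_assoc]
    _ = ρ' g * (Q'.1 * (↑Q'⁻¹ : Mat2 R)) := by rw [e1, mul_one, ← hQ', mul_assoc]
    _ = ρ' g := by rw [e2, mul_one]

/-- `ρ` and `ρ'` have the same traces and determinants. -/
def SSRep.SameCharacter (ρ ρ' : SSRep G X) : Prop :=
  ∀ g, (ρ.1 g).trace = (ρ'.1 g).trace ∧ (ρ.1 g).det = (ρ'.1 g).det

theorem SSRep.minorsVanish (ρ : SSRep G X) (a b c : G) :
    MinorsVanish (ρ.1 a) (ρ.1 b) (ρ.1 c) :=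
  ρ.1.minorsVanish ρ.2.1 a b c

theorem SSRep.pullback_apply (j : Y ⟶ X) (ρ : SSRep G X) (g : G) :
    (ρ.pullback j).1 g = j.appTop.hom.mapMatrix (ρ.1 g) := rfl

theorem SSRep.SameCharacter.pullback {ρ ρ' : SSRep G X} (h : ρ.SameCharacter ρ') (j : Y ⟶ X) :
    (ρ.pullback j).SameCharacter (ρ'.pullback j) := by
  intro g
  simp only [SSRep.pullback_apply, ← (map_trace_det j.appTop.hom _).1,
    ← (map_trace_det j.appTop.hom _).2, (h g).1, (h g).2, and_self]

/-- Representations with semi-simple mold and the same character are conjugate near each point `x`.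
The neighbourhood is the basic open set of a global function `f`, and the conjugating matrix is
provided over every `W ⟶ X` on which `f` is invertible. -/
theorem SSRep.SameCharacter.exists_conj {ρ ρ' : SSRep G X} (h : ρ.SameCharacter ρ') (x : X) :
    ∃ f : Γ(X, ⊤), x ∈ X.basicOpen f ∧ ∀ (W : Scheme.{u}) (j : W ⟶ X), IsUnit (j.appTop.hom f) →
      ∃ P : GL (Fin 2) Γ(W, ⊤), ∀ g, (↑P⁻¹ : Mat2 Γ(W, ⊤)) * (ρ.pullback j).1 g * P.1 =
        (ρ'.pullback j).1 g := by
  obtain ⟨c, hc⟩ := ρ.2.exists_mem_basicOpen x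
  have hc' : x ∈ X.basicOpen (disc (ρ'.1 c)) := by
    have : disc (ρ'.1 c) = disc (ρ.1 c) := by rw [disc, disc, (h c).1, (h c).2]
    rwa [this]
  let ev : Γ(X, ⊤) →+* X.residueField x := (X.evaluation ⊤ x trivial).hom
  have hev : ∀ f, ev f ≠ 0 ↔ x ∈ X.basicOpen f := fun f =>
    Scheme.evaluation_ne_zero_iff_mem_basicOpen X x (U := ⊤) trivial f
  obtain ⟨v, hv⟩ := exists_det_cyclicMatrix_ne_zero ev (ρ.1 c) ((hev _).mpr hc)
  obtain ⟨v', hv'⟩ := exists_det_cyclicMatrix_ne_zero ev (ρ'.1 c) ((hev _).mpr hc')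
  refine ⟨disc (ρ.1 c) * ((cyclicMatrix (ρ.1 c) v).det * (cyclicMatrix (ρ'.1 c) v').det), ?_, ?_⟩
  · rw [Scheme.basicOpen_mul, Scheme.basicOpen_mul]
    exact ⟨hc, (hev _).mp hv, (hev _).mp hv'⟩
  · intro W j hj
    rw [map_mul, map_mul, IsUnit.mul_iff, IsUnit.mul_iff] at hj
    have hW := h.pullback j
    refine exists_conj_of_cyclic (ρ.pullback j).1 (ρ'.pullback j).1 (ρ.pullback j).minorsVanish
      (ρ'.pullback j).minorsVanish (fun g => (hW g).1) (fun g => (hW g).2) c ?_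
      (j.appTop.hom ∘ v) (j.appTop.hom ∘ v') ?_ ?_
    · rw [SSRep.pullback_apply, disc_map]
      exact hj.1
    · rw [SSRep.pullback_apply, ← cyclicMatrix_map, ← (map_trace_det j.appTop.hom _).2]
      exact hj.2.1
    · rw [SSRep.pullback_apply, ← cyclicMatrix_map, ← (map_trace_det j.appTop.hom _).2]
      exact hj.2.2

end conjugacy

/-! ### Morphisms to the moduli scheme -/

section morphisms

variable {G : Type u} [Monoid G] {X Y : Scheme.{u}}

/-- The inclusion of `Ch₂(G)_{s.s.}` in the affine scheme `Ch₂(G)_{rk ≤ 2}`. -/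
noncomputable def chSSι (G : Type u) [Monoid G] : chSS G ⟶ chRk G := (chSSOpen G).ι

instance : IsOpenImmersion (chSSι G) :=
  inferInstanceAs (IsOpenImmersion (Scheme.Opens.ι (X := chRk G) (chSSOpen G)))

instance : IsAffine (chRk G) := by unfold chRk; infer_instance

/-- The ring homomorphism corresponding to a morphism to the affine scheme `Ch₂(G)_{rk ≤ 2}`. -/
noncomputable def rkChar (h : X ⟶ chRk G) : A2rkCh G →+* Γ(X, ⊤) :=
  ((Scheme.ΓSpecIso (CommRingCat.of (A2rkCh G))).inv ≫ h.appTop).hom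

theorem preimage_basicOpen_chRk (h : X ⟶ chRk G) (a : A2rkCh G) :
    h ⁻¹ᵁ (PrimeSpectrum.basicOpen a) = X.basicOpen (rkChar h a) := by
  have h1 := basicOpen_eq_of_affine (R := CommRingCat.of (A2rkCh G)) a
  exact (congrArg (h ⁻¹ᵁ ·) h1).symm.trans (Scheme.preimage_basicOpen_top h _)

/-- The pullback of functions along a morphism to `Ch₂(G)_{s.s.}`. -/
noncomputable def homChar (f : X ⟶ chSS G) : A2rkCh G →+* Γ(X, ⊤) := f.appTop.hom.comp (chFun G)

theorem homChar_eq (f : X ⟶ chSS G) : homChar f = rkChar (f ≫ chSSι G) := rfl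

theorem homChar_comp (j : Y ⟶ X) (f : X ⟶ chSS G) :
    homChar (j ≫ f) = j.appTop.hom.comp (homChar f) := rfl

theorem homChar_injective {f f' : X ⟶ chSS G} (h : homChar f = homChar f') : f = f' := by
  rw [← cancel_mono (chSSι G)]
  refine ext_of_isAffine ?_
  exact (cancel_epi (Scheme.ΓSpecIso (CommRingCat.of (A2rkCh G))).inv).mp
    (CommRingCat.hom_ext h)

theorem exists_mem_basicOpen_homChar (f : X ⟶ chSS G) (x : X) :
    ∃ g : G, x ∈ X.basicOpen (homChar f (discCh g)) := by
  have hx : (chSSι G) (f x) ∈ chSSOpen G := (f x).2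
  obtain ⟨g, hg⟩ := TopologicalSpace.Opens.mem_iSup.mp hx
  refine ⟨g, ?_⟩
  rw [homChar_eq, ← preimage_basicOpen_chRk]
  exact hg

theorem rkChar_toSpecΓ (φ : A2rkCh G →+* Γ(X, ⊤)) :
    rkChar (G := G) (X.toSpecΓ ≫ Spec.map (CommRingCat.ofHom φ)) = φ := by
  have : (Scheme.ΓSpecIso (CommRingCat.of (A2rkCh G))).inv ≫
      (X.toSpecΓ ≫ Spec.map (CommRingCat.ofHom φ)).appTop = CommRingCat.ofHom φ := by
    rw [Scheme.Hom.comp_appTop, Scheme.toSpecΓ_appTop, ← Category.assoc,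
      ← Scheme.ΓSpecIso_inv_naturality, Category.assoc, Iso.inv_hom_id, Category.comp_id]
  exact congrArg CommRingCat.Hom.hom this

/-- Together with `homChar_injective`, `exists_mem_basicOpen_homChar`: morphisms to
`Ch₂(G)_{s.s.}` are the ring homomorphisms `φ` for which the functions `φ(m(σ_G(g)))` have no
common zero. -/
theorem exists_homChar_eq (φ : A2rkCh G →+* Γ(X, ⊤))
    (hφ : ∀ x : X, ∃ g : G, x ∈ X.basicOpen (φ (discCh g))) :
    ∃ f : X ⟶ chSS G, homChar f = φ := by
  let h : X ⟶ chRk G := X.toSpecΓ ≫ Spec.map (CommRingCat.ofHom φ)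
  have hh : rkChar h = φ := rkChar_toSpecΓ φ
  have hrange : Set.range h ⊆ Set.range (chSSι G) := by
    rintro _ ⟨x, rfl⟩
    obtain ⟨g, hg⟩ := hφ x
    rw [← hh, ← preimage_basicOpen_chRk] at hg
    have h1 : h x ∈ chSSOpen G := TopologicalSpace.Opens.mem_iSup.mpr ⟨g, hg⟩
    exact ⟨⟨h x, h1⟩, rfl⟩
  refine ⟨IsOpenImmersion.lift (chSSι G) h hrange, ?_⟩
  rw [homChar_eq, IsOpenImmersion.lift_fac, hh]

theorem isCharacterOf_iff {f : X ⟶ chSS G} {ρ : SSRep G X} :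
    IsCharacterOf f ρ ↔ ∀ g, homChar f (trCh g) = (ρ.1 g).trace ∧
      homChar f (detCh g) = (ρ.1 g).det := Iff.rfl

theorem IsCharacterOf.unique {f f' : X ⟶ chSS G} {ρ : SSRep G X} (h : IsCharacterOf f ρ)
    (h' : IsCharacterOf f' ρ) : f = f' :=
  homChar_injective (A2rkCh_hom_ext (fun g => (h g).1.trans (h' g).1.symm)
    fun g => (h g).2.trans (h' g).2.symm)

theorem exists_isCharacterOf (ρ : SSRep G X) : ∃ f : X ⟶ chSS G, IsCharacterOf f ρ := by
  obtain ⟨φ, hφ⟩ := exists_charHom ρ.1 ρ.minorsVanish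
  have hdisc : ∀ g, φ (discCh g) = disc (ρ.1 g) := by
    intro g
    simp [discCh, disc, hφ, map_ofNat φ 4]
  obtain ⟨f, hf⟩ := exists_homChar_eq φ (fun x => by
    simp only [hdisc]
    exact ρ.2.exists_mem_basicOpen x)
  exact ⟨f, by rw [isCharacterOf_iff, hf]; exact hφ⟩

theorem IsCharacterOf.pullback {f : X ⟶ chSS G} {ρ : SSRep G X} (h : IsCharacterOf f ρ)
    (j : Y ⟶ X) : IsCharacterOf (j ≫ f) (ρ.pullback j) := by
  rw [isCharacterOf_iff] at h ⊢
  intro g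
  rw [homChar_comp, SSRep.pullback_apply, ← (map_trace_det j.appTop.hom _).1,
    ← (map_trace_det j.appTop.hom _).2, ← (h g).1, ← (h g).2]
  exact ⟨rfl, rfl⟩

theorem IsCharacterOf.sameCharacter {f : X ⟶ chSS G} {ρ ρ' : SSRep G X} (h : IsCharacterOf f ρ)
    (h' : IsCharacterOf f ρ') : ρ.SameCharacter ρ' :=
  fun g => ⟨(h g).1.symm.trans (h' g).1, (h g).2.symm.trans (h' g).2⟩

theorem IsCharacterOf.of_sameCharacter {f : X ⟶ chSS G} {ρ ρ' : SSRep G X} (h : IsCharacterOf f ρ)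
    (h' : ρ.SameCharacter ρ') : IsCharacterOf f ρ' :=
  fun g => ⟨(h g).1.trans (h' g).1, (h g).2.trans (h' g).2⟩

/-- Where some `m(σ_G(c))` is invertible, the standard representation realizes the morphism `f`. -/
theorem exists_ssRep_of_isUnit (f : X ⟶ chSS G) (c : G) (hc : IsUnit (homChar f (discCh c))) :
    ∃ ρ : SSRep G X, IsCharacterOf f ρ := by
  let ρ : Rep2 G X := stdRep (homChar f) c hc
  have hρc : ρ c = companion (homChar f (trCh c)) (homChar f (detCh c)) := stdRep_self _ c hc
  refine ⟨⟨ρ, ρ.hasSemisimpleMold_of_companion c _ _ hρc (fun g => ?_) ?_⟩,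
    fun g => ⟨(trace_stdRep _ c hc g).symm, (det_stdRep _ c hc g).symm⟩⟩
  · refine ⟨↑hc.unit⁻¹ * homChar f (chX c g), ↑hc.unit⁻¹ * homChar f (chY c g), ?_⟩
    rw [hρc, mul_smul, mul_smul, ← smul_add]
    rfl
  · have : disc (ρ c) = homChar f (discCh c) := by
      simp [hρc, disc, trace_companion, det_companion, discCh, map_ofNat (homChar f) 4]
    rwa [this]

theorem isUnit_appTop_of_mem_basicOpen (j : Y ⟶ X) (f : Γ(X, ⊤))
    (h : ∀ y, j y ∈ X.basicOpen f) : IsUnit (j.appTop.hom f) := by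
  refine RingedSpace.isUnit_of_isUnit_germ Y.toRingedSpace ⊤ _ fun y hy => ?_
  have : y ∈ Y.basicOpen (j.appTop f) := by
    rw [← Scheme.preimage_basicOpen_top]
    exact h y
  exact (Scheme.mem_basicOpen_top _ _ _).mp this

/-- Locally on `X`, every morphism to `Ch₂(G)_{s.s.}` is given by a representation. -/
theorem exists_local_ssRep (f : X ⟶ chSS G) (x : X) :
    ∃ U : X.Opens, x ∈ U ∧ ∃ ρ : SSRep G (U : Scheme.{u}), IsCharacterOf (U.ι ≫ f) ρ := by
  obtain ⟨c, hc⟩ := exists_mem_basicOpen_homChar f x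
  refine ⟨X.basicOpen (homChar f (discCh c)), hc, exists_ssRep_of_isUnit _ c ?_⟩
  exact isUnit_appTop_of_mem_basicOpen (X.basicOpen (homChar f (discCh c))).ι _ fun y => y.2

end morphisms

/-! ### Generalized representations -/

section generalized

variable {G : Type u} [Monoid G] {X Y Z : Scheme.{u}}

theorem SSRep.pullback_comp (f : Y ⟶ X) (h : Z ⟶ Y) (ρ : SSRep G X) :
    ρ.pullback (h ≫ f) = (ρ.pullback f).pullback h :=
  Subtype.ext (Rep2.pullback_comp f h ρ.1)

theorem hom_ext_of_opens {f g : X ⟶ Y} (h : ∀ x : X, ∃ U : X.Opens, x ∈ U ∧ U.ι ≫ f = U.ι ≫ g) :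
    f = g := by
  choose U hU hfg using h
  have hc : TopologicalSpace.IsOpenCover U :=
    eq_top_iff.mpr fun x _ => TopologicalSpace.Opens.mem_iSup.mpr ⟨x, hU x⟩
  exact Scheme.Cover.hom_ext (X.openCoverOfIsOpenCover U hc) _ _ hfg

theorem sameCharacter_of_conj {ρ ρ' : SSRep G X} (P : GL (Fin 2) Γ(X, ⊤))
    (h : ∀ g, (↑P⁻¹ : Mat2 Γ(X, ⊤)) * ρ.1 g * P.1 = ρ'.1 g) : ρ.SameCharacter ρ' := by
  intro g
  rw [← h]
  exact ⟨(Matrix.trace_units_conj' P _).symm, (Matrix.det_units_conj' P _).symm⟩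

/-- The characters of the members of a generalized representation agree on overlaps, because
conjugate representations have the same character; so they glue. -/
theorem IsGenRep.exists_hom {s : Set (Σ U : X.Opens, SSRep G (U : Scheme.{u}))}
    (hs : IsGenRep s) : ∃ f : X ⟶ chSS G, ∀ p ∈ s, IsCharacterOf (p.1.ι ≫ f) p.2 := by
  choose χ hχ using fun p : s => exists_isCharacterOf p.1.2
  have hc : TopologicalSpace.IsOpenCover fun p : s => p.1.1 := by
    refine eq_top_iff.mpr fun x _ => TopologicalSpace.Opens.mem_iSup.mpr ?_
    obtain ⟨p, hp, hx⟩ := hs.covers x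
    exact ⟨⟨p, hp⟩, hx⟩
  let 𝒰 : X.OpenCover := X.openCoverOfIsOpenCover (fun p : s => p.1.1) hc
  have hcompat : ∀ p q : s, Limits.pullback.fst p.1.1.ι q.1.1.ι ≫ χ p =
      Limits.pullback.snd p.1.1.ι q.1.1.ι ≫ χ q := by
    intro p q
    refine hom_ext_of_opens fun z => ?_
    set a := Limits.pullback.fst p.1.1.ι q.1.1.ι
    set b := Limits.pullback.snd p.1.1.ι q.1.1.ι
    have hab : a ≫ p.1.1.ι = b ≫ q.1.1.ι := Limits.pullback.condition
    have hx : (a ≫ p.1.1.ι) z ∈ q.1.1 := by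
      rw [hab]
      exact (b z).2
    obtain ⟨V, hp, hq, hxV, P, hP⟩ := hs.locally_conj p.1 p.2 q.1 q.2 _ (a z).2 hx
    have hVχ : X.homOfLE hp ≫ χ p = X.homOfLE hq ≫ χ q :=
      (((hχ p).pullback (X.homOfLE hp)).of_sameCharacter (sameCharacter_of_conj P hP)).unique
        ((hχ q).pullback (X.homOfLE hq))
    -- Near `z` both composites factor through `V`, where the two representations are conjugate.
    let W : (Limits.pullback p.1.1.ι q.1.1.ι).Opens := (a ≫ p.1.1.ι) ⁻¹ᵁ V
    have hrange : Set.range (W.ι ≫ a ≫ p.1.1.ι) ⊆ Set.range V.ι := by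
      rintro _ ⟨w, rfl⟩
      rw [Scheme.Opens.range_ι]
      exact w.2
    let l : (W : Scheme.{u}) ⟶ V := IsOpenImmersion.lift V.ι (W.ι ≫ a ≫ p.1.1.ι) hrange
    have hl : l ≫ V.ι = W.ι ≫ a ≫ p.1.1.ι := IsOpenImmersion.lift_fac _ _ _
    have h1 : W.ι ≫ a = l ≫ X.homOfLE hp := by
      rw [← cancel_mono p.1.1.ι, Category.assoc, Category.assoc, Scheme.homOfLE_ι, hl]
    have h2 : W.ι ≫ b = l ≫ X.homOfLE hq := by
      rw [← cancel_mono q.1.1.ι, Category.assoc, Category.assoc, Scheme.homOfLE_ι, hl, hab]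
    refine ⟨W, hxV, ?_⟩
    rw [← Category.assoc, ← Category.assoc, h1, h2, Category.assoc, Category.assoc, hVχ]
  refine ⟨Scheme.Cover.glueMorphisms 𝒰 χ hcompat, fun p hp => ?_⟩
  have := Scheme.Cover.ι_glueMorphisms 𝒰 χ hcompat ⟨p, hp⟩
  have h2 : p.1.ι ≫ Scheme.Cover.glueMorphisms 𝒰 χ hcompat = χ ⟨p, hp⟩ := this
  rw [h2]
  exact hχ ⟨p, hp⟩

/-- Representations whose characters are restrictions of one morphism `f` form a generalized
representation as soon as their domains cover `X`. -/
theorem isGenRep_of_hom (f : X ⟶ chSS G) {s : Set (Σ U : X.Opens, SSRep G (U : Scheme.{u}))}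
    (hcov : ∀ x : X, ∃ p ∈ s, x ∈ p.1) (hs : ∀ p ∈ s, IsCharacterOf (p.1.ι ≫ f) p.2) :
    IsGenRep s where
  covers := hcov
  locally_conj p hp q hq x hxp hxq := by
    let Z : X.Opens := p.1 ⊓ q.1
    have hZp : Z ≤ p.1 := inf_le_left
    have hZq : Z ≤ q.1 := inf_le_right
    have h1 := (hs p hp).pullback (X.homOfLE hZp)
    have h2 := (hs q hq).pullback (X.homOfLE hZq)
    rw [← Category.assoc, Scheme.homOfLE_ι] at h1 h2
    obtain ⟨a, ha, hconj⟩ := (h1.sameCharacter h2).exists_conj (⟨x, hxp, hxq⟩ : Z)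
    let V : X.Opens := Z.ι ''ᵁ ((Z : Scheme.{u}).basicOpen a)
    have hVZ : V ≤ Z := by
      rintro _ ⟨y, -, rfl⟩
      exact y.2
    refine ⟨V, hVZ.trans hZp, hVZ.trans hZq, ⟨_, ha, rfl⟩, ?_⟩
    obtain ⟨P, hP⟩ := hconj V (X.homOfLE hVZ) (isUnit_appTop_of_mem_basicOpen _ _ fun y => by
      obtain ⟨z, hz, hzy⟩ := y.2
      have : X.homOfLE hVZ y = z := Subtype.ext ((X.homOfLE_apply hVZ y).trans hzy.symm)
      rw [this]
      exact hz)
    refine ⟨P, fun g => ?_⟩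
    have := hP g
    rwa [← SSRep.pullback_comp, ← SSRep.pullback_comp, Scheme.homOfLE_homOfLE,
      Scheme.homOfLE_homOfLE] at this

theorem hom_unique_of_covers {s : Set (Σ U : X.Opens, SSRep G (U : Scheme.{u}))}
    (hcov : ∀ x : X, ∃ p ∈ s, x ∈ p.1) {f f' : X ⟶ chSS G}
    (hf : ∀ p ∈ s, IsCharacterOf (p.1.ι ≫ f) p.2) (hf' : ∀ p ∈ s, IsCharacterOf (p.1.ι ≫ f') p.2) :
    f = f' := by
  refine hom_ext_of_opens fun x => ?_
  obtain ⟨p, hp, hx⟩ := hcov x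
  exact ⟨p.1, hx, (hf p hp).unique (hf' p hp)⟩

/-- The family of all representations on open subsets of `X` whose character is the restriction of
`f`. -/
def genRepOfHom (f : X ⟶ chSS G) : GenRep G X :=
  ⟨{p | IsCharacterOf (p.1.ι ≫ f) p.2}, isGenRep_of_hom f (fun x => by
    obtain ⟨U, hx, ρ, hρ⟩ := exists_local_ssRep f x
    exact ⟨⟨U, ρ⟩, hρ, hx⟩) fun _ hp => hp⟩

/-- The morphism given by the traces and determinants of a generalized representation. -/
noncomputable def GenRep.hom (s : GenRep G X) : X ⟶ chSS G := s.2.exists_hom.choose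

theorem GenRep.isCharacterOf_hom (s : GenRep G X) :
    ∀ p ∈ s.1, IsCharacterOf (p.1.ι ≫ s.hom) p.2 := s.2.exists_hom.choose_spec

theorem GenRep.hom_eq_of_equivalent {s t : GenRep G X} (h : s.Equivalent t) : s.hom = t.hom := by
  obtain ⟨f, hf⟩ := IsGenRep.exists_hom h
  exact (hom_unique_of_covers s.2.covers s.isCharacterOf_hom fun p hp => hf p (Or.inl hp)).trans
    (hom_unique_of_covers t.2.covers (fun p hp => hf p (Or.inr hp)) t.isCharacterOf_hom)

/-- Morphisms to `Ch₂(G)_{s.s.}` are equivalence classes of generalized representations; the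
inverse is induced by `GenRep.hom`. -/
noncomputable def homEquivGenRep (G : Type u) [Monoid G] (X : Scheme.{u}) :
    (X ⟶ chSS G) ≃ Quot (GenRep.Equivalent (G := G) (X := X)) where
  toFun f := Quot.mk _ (genRepOfHom f)
  invFun := Quot.lift GenRep.hom fun _ _ => GenRep.hom_eq_of_equivalent
  left_inv f := hom_unique_of_covers (genRepOfHom f).2.covers
    (genRepOfHom f).isCharacterOf_hom fun _ hp => hp
  right_inv q := by
    induction q using Quot.ind with
    | mk s =>
      refine Quot.sound (isGenRep_of_hom s.hom (fun x => ?_) ?_)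
      · obtain ⟨p, hp, hx⟩ := s.2.covers x
        exact ⟨p, Or.inr hp, hx⟩
      · rintro p (hp | hp)
        · exact hp
        · exact s.isCharacterOf_hom p hp

end generalized

/-! ### Representability of the sheafification -/

section representability

variable {G : Type u} [Monoid G] {X Y : Scheme.{u}}

theorem mem_zariskiTopology_of_opens (S : Sieve X) (h : ∀ x : X, ∃ U : X.Opens, x ∈ U ∧ S U.ι) :
    S ∈ Scheme.zariskiTopology.{u} X := by
  choose U hU hS using h
  have hc : TopologicalSpace.IsOpenCover U :=
    eq_top_iff.mpr fun x _ => TopologicalSpace.Opens.mem_iSup.mpr ⟨x, hU x⟩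
  refine Scheme.zariskiTopology.superset_covering ?_
    (X.openCoverOfIsOpenCover U hc).mem_grothendieckTopology
  rw [Sieve.ofArrows, Sieve.generate_le_iff]
  rintro _ _ ⟨x⟩
  exact hS x

/-- Conjugation `M ↦ P⁻¹ M P` as an algebra automorphism. -/
def conjAlgEquiv {R : Type*} [CommRing R] (P : GL (Fin 2) R) : Mat2 R ≃ₐ[R] Mat2 R :=
  AlgEquiv.ofLinearEquiv
    { toFun := fun M => (↑P⁻¹ : Mat2 R) * M * P.1
      invFun := fun M => P.1 * M * (↑P⁻¹ : Mat2 R)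
      map_add' := fun M N => by rw [mul_add, add_mul]
      map_smul' := fun r M => by simp
      left_inv := fun M => by simp [mul_assoc]
      right_inv := fun M => by simp [mul_assoc] }
    (by simp) (fun M N => by simp [mul_assoc])

theorem SSRep.sameCharacter_of_equivalent {ρ ρ' : SSRep G X} (h : ρ.1.Equivalent ρ'.1) :
    ρ.SameCharacter ρ' := by
  obtain ⟨σ, hσ⟩ := h
  intro g
  rw [← hσ]
  exact ⟨(algEquiv_trace_det σ _).1.symm, (algEquiv_trace_det σ _).2.symm⟩

/-- The morphism to `Ch₂(G)_{s.s.}` given by the traces and determinants of `ρ`. -/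
noncomputable def charMor (ρ : SSRep G X) : X ⟶ chSS G := (exists_isCharacterOf ρ).choose

theorem isCharacterOf_charMor (ρ : SSRep G X) : IsCharacterOf (charMor ρ) ρ :=
  (exists_isCharacterOf ρ).choose_spec

theorem charMor_eq_of_equivalent {ρ ρ' : SSRep G X} (h : ρ.1.Equivalent ρ'.1) :
    charMor ρ = charMor ρ' :=
  ((isCharacterOf_charMor ρ).of_sameCharacter (SSRep.sameCharacter_of_equivalent h)).unique
    (isCharacterOf_charMor ρ')

theorem charMor_pullback (j : Y ⟶ X) (ρ : SSRep G X) : charMor (ρ.pullback j) = j ≫ charMor ρ :=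
  (isCharacterOf_charMor _).unique ((isCharacterOf_charMor ρ).pullback j)

/-- The functor of points of `Ch₂(G)_{s.s.}`, with values in the universe of `eqSS G`. -/
noncomputable abbrev chSSFunctor (G : Type u) [Monoid G] : Scheme.{u}ᵒᵖ ⥤ Type (u + 1) :=
  uliftYoneda.{u + 1}.obj (chSS G)

theorem isSheaf_chSSFunctor : Presheaf.IsSheaf Scheme.zariskiTopology.{u} (chSSFunctor G) :=
  (Scheme.zariskiTopology.{u}.uliftYoneda.{u + 1}.obj (chSS G)).property

/-- The natural transformation that sends the class of `ρ` to the morphism given by its traces and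
determinants. -/
noncomputable def charTrans (G : Type u) [Monoid G] :
    preEqSS G ⋙ uliftFunctor.{u + 1} ⟶ chSSFunctor G where
  app X := TypeCat.ofHom fun q => ULift.up
    (Quotient.lift (s := SSRep.setoid G X.unop) charMor (fun _ _ => charMor_eq_of_equivalent)
      q.down)
  naturality X Y f := by
    ext ⟨q⟩
    induction q using Quotient.inductionOn with
    | h ρ => exact congrArg ULift.up (charMor_pullback f.unop ρ)

/-- Representations with the same character are locally conjugate, hence locally equivalent. -/
instance : Presheaf.IsLocallyInjective Scheme.zariskiTopology.{u} (charTrans G) where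
  equalizerSieve_mem {X} := by
    rintro ⟨q⟩ ⟨q'⟩ h
    induction q, q' using Quotient.inductionOn₂ with
    | h ρ ρ' =>
      have h1 : charMor ρ = charMor ρ' := congrArg ULift.down h
      have h2 : ρ.SameCharacter ρ' :=
        (isCharacterOf_charMor ρ).sameCharacter (h1 ▸ isCharacterOf_charMor ρ')
      refine mem_zariskiTopology_of_opens _ fun x => ?_
      obtain ⟨f, hx, hf⟩ := h2.exists_conj x
      refine ⟨_, hx, ?_⟩
      obtain ⟨P, hP⟩ := hf _ (X.unop.basicOpen f).ι
        (isUnit_appTop_of_mem_basicOpen _ _ fun y => y.2)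
      exact congrArg ULift.up (Quotient.sound (s := SSRep.setoid G _) ⟨conjAlgEquiv P, hP⟩)

/-- Every morphism to `Ch₂(G)_{s.s.}` is locally the character of a standard representation. -/
instance : Presheaf.IsLocallySurjective Scheme.zariskiTopology.{u} (charTrans G) where
  imageSieve_mem {X} := by
    rintro ⟨f⟩
    refine mem_zariskiTopology_of_opens _ fun x => ?_
    obtain ⟨U, hx, ρ, hρ⟩ := exists_local_ssRep (G := G) f x
    exact ⟨U, hx, ULift.up (Quotient.mk (SSRep.setoid G _) ρ),
      congrArg ULift.up ((isCharacterOf_charMor ρ).unique hρ)⟩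

/-- The extension of `charTrans G` to the sheafification. -/
noncomputable def eqSSHom (G : Type u) [Monoid G] : eqSS G ⟶ chSSFunctor G :=
  sheafifyLift Scheme.zariskiTopology.{u} (charTrans G) isSheaf_chSSFunctor

theorem toSheafify_eqSSHom : toSheafify Scheme.zariskiTopology.{u} _ ≫ eqSSHom G = charTrans G :=
  toSheafify_sheafifyLift _ _ _

/-- `charTrans G` is locally bijective and its target is a sheaf, so it exhibits that target as the
sheafification. -/
instance : IsIso (eqSSHom G) := by
  let J := Scheme.zariskiTopology.{u}
  have h1 : J.W (toSheafify J (preEqSS G ⋙ uliftFunctor.{u + 1})) := J.W_toSheafify _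
  have h2 : J.W (charTrans G) := J.W_of_isLocallyBijective _
  rw [← toSheafify_eqSSHom] at h2
  have h3 : J.W (eqSSHom G) := (J.W.precomp_iff _ _ h1).mp h2
  let φ : (presheafToSheaf J _).obj (preEqSS G ⋙ uliftFunctor.{u + 1}) ⟶
    ⟨chSSFunctor G, isSheaf_chSSFunctor⟩ := ⟨eqSSHom G⟩
  have h4 : IsIso φ := (J.W_sheafToPresheaf_map_iff_isIso φ).mp h3
  exact inferInstanceAs (IsIso ((sheafToPresheaf J _).map φ))

/-- `Ch₂(G)_{s.s.}` represents `EqSS₂(G)`, by way of `eqSSHom G`. -/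
noncomputable def eqSSRepresentableBy (G : Type u) [Monoid G] :
    (eqSS G).RepresentableBy (chSS G) where
  homEquiv {X} := Equiv.ulift.symm.trans ((asIso (eqSSHom G)).app (op X)).symm.toEquiv
  homEquiv_comp {X X'} f g := by
    let x : (chSSFunctor G).obj (op X') := ULift.up g
    exact NatTrans.naturality_apply (inv (eqSSHom G)) f.op x

theorem isCharacterOf_homEquiv_symm (ρ : SSRep G X) :
    IsCharacterOf ((eqSSRepresentableBy G).homEquiv.symm (eqSSClass ρ)) ρ := by
  have : (eqSSRepresentableBy G).homEquiv.symm (eqSSClass ρ) = charMor ρ := by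
    have h := congrArg (fun τ => τ.app (op X) (ULift.up (Quotient.mk (SSRep.setoid G X) ρ)))
      (toSheafify_eqSSHom (G := G))
    exact congrArg ULift.down h
  rw [this]
  exact isCharacterOf_charMor ρ

end representability

/-! ### Separatedness and finiteness -/

section finiteness

variable {G : Type u} [Monoid G]

/-- `Ch₂(G)_{s.s.}` is open in an affine scheme. -/
instance : IsSeparated (toSpecZ (chSS G)) := by
  have : toSpecZ (chSS G) = chSSι G ≫ toSpecZ (chRk G) := specULiftZIsTerminal.hom_ext _ _
  rw [this]
  infer_instance

/-- The image of the trace/determinant subring lies in any subring that contains the entries of the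
standard representation at generators of `G`. -/
theorem mem_of_stdRep_mem {R : Type*} [CommRing R] (φ : A2rkCh G →+* R) (c : G)
    (hc : IsUnit (φ (discCh c))) {S : Set G} (hS : Submonoid.closure S = ⊤) (R' : Subring R)
    (h : ∀ s ∈ S, ∀ i j, stdRep φ c hc s i j ∈ R') (a : A2rkCh G) : φ a ∈ R' := by
  have hG : ∀ g i j, stdRep φ c hc g i j ∈ R' := by
    intro g
    have hg : g ∈ Submonoid.closure S := hS ▸ trivial
    induction hg using Submonoid.closure_induction with
    | mem s hs => exact h s hs
    | one =>
      intro i j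
      rw [map_one, Matrix.one_apply]
      split_ifs
      exacts [one_mem _, zero_mem _]
    | mul g k _ _ hg hk =>
      intro i j
      rw [map_mul, Matrix.mul_apply]
      exact sum_mem fun l _ => mul_mem (hg i l) (hk l j)
  have hle : Subring.closure (Set.range (trCh (G := G)) ∪ Set.range detCh) ≤ R'.comap φ := by
    rw [Subring.closure_le]
    rintro _ (⟨g, rfl⟩ | ⟨g, rfl⟩)
    · change φ _ ∈ R'
      rw [← trace_stdRep φ c hc, Matrix.trace_fin_two]
      exact add_mem (hG g 0 0) (hG g 1 1)
    · change φ _ ∈ R'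
      rw [← det_stdRep φ c hc, Matrix.det_fin_two]
      exact sub_mem (mul_mem (hG g 0 0) (hG g 1 1)) (mul_mem (hG g 0 1) (hG g 1 0))
  rw [closure_trCh_detCh] at hle
  exact hle trivial

/-- Generators over any base ring `A` are the inverse of `m(σ_G(c))` and the entries of the standard
representation at generators of `G`. -/
theorem finiteType_away_discCh {A : Type*} [CommRing A] (hG : Monoid.FG G) (c : G)
    (ψ : A →+* Localization.Away (discCh c)) : ψ.FiniteType := by
  obtain ⟨S, hS⟩ := hG.fg_top
  algebraize [ψ]
  let φ := algebraMap (A2rkCh G) (Localization.Away (discCh c))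
  have hc : IsUnit (φ (discCh c)) := IsLocalization.Away.algebraMap_isUnit _
  let T : Set (Localization.Away (discCh c)) :=
    insert (IsLocalization.Away.invSelf (discCh c))
      (⋃ s ∈ S, Set.range fun ij : Fin 2 × Fin 2 => stdRep φ c hc s ij.1 ij.2)
  have hT : T.Finite := (S.finite_toSet.biUnion fun s _ => Set.finite_range _).insert _
  have hφ : ∀ a, φ a ∈ (Algebra.adjoin A T).toSubring :=
    mem_of_stdRep_mem φ c hc hS _ fun s hs i j => Algebra.subset_adjoin
      (Or.inr (Set.mem_biUnion hs ⟨(i, j), rfl⟩))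
  refine ⟨⟨hT.toFinset, ?_⟩⟩
  rw [Set.Finite.coe_toFinset, eq_top_iff]
  intro z _
  obtain ⟨n, a, ha⟩ := IsLocalization.Away.surj (discCh c) z
  have hu := IsLocalization.Away.mul_invSelf (S := Localization.Away (discCh c)) (discCh c)
  have hz : z = φ a * IsLocalization.Away.invSelf (discCh c) ^ n := by
    have ha' : z * φ (discCh c) ^ n = φ a := ha
    rw [← ha', mul_assoc, ← mul_pow, hu, one_pow, mul_one]
  rw [hz]
  exact mul_mem (hφ a) (pow_mem (Algebra.subset_adjoin (Set.mem_insert _ _)) n)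

/-- The basic open sets at generators of `G` already cover `Ch₂(G)_{s.s.}`. If all `m(σ_G(s))`
vanish at a point `p` where `m(σ_G(c))` does not, then at `p` the coefficient `Y(s)` of `σ_G(c)`
vanishes for all generators `s`, hence `Y(g)` vanishes for all `g`; but `Y(c) = m(σ_G(c))`. -/
theorem chSSOpen_eq_iSup {S : Set G} (hS : Submonoid.closure S = ⊤) :
    chSSOpen G = ⨆ s ∈ S, PrimeSpectrum.basicOpen (discCh s) := by
  refine le_antisymm (iSup_le fun c p (hp : discCh c ∉ p.asIdeal) => ?_)
    (iSup₂_le fun s _ => le_iSup (fun g : G => PrimeSpectrum.basicOpen (discCh g)) s)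
  by_contra hcon
  have hs : ∀ s ∈ S, discCh s ∈ p.asIdeal := by
    intro s hs
    by_contra h
    exact hcon (TopologicalSpace.Opens.mem_iSup.mpr
      ⟨s, TopologicalSpace.Opens.mem_iSup.mpr ⟨hs, h⟩⟩)
  have hY : ∀ g, chY c g ∈ p.asIdeal := by
    intro g
    have hg : g ∈ Submonoid.closure S := hS ▸ trivial
    induction hg using Submonoid.closure_induction with
    | mem s h =>
      have h1 : chY c s ^ 2 * discCh c ∈ p.asIdeal := by
        rw [← discCh_sq_mul]
        exact Ideal.mul_mem_left _ _ (hs s h)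
      exact p.isPrime.mem_of_pow_mem 2 ((p.isPrime.mem_or_mem h1).resolve_right hp)
    | one => rw [chY_one]; exact zero_mem _
    | mul g k _ _ hg hk =>
      have h1 : discCh c * chY c (g * k) ∈ p.asIdeal := by
        rw [discCh_mul_chY]
        exact add_mem (add_mem (Ideal.mul_mem_left _ _ hk) (Ideal.mul_mem_right _ _ hg))
          (Ideal.mul_mem_right _ _ (Ideal.mul_mem_left _ _ hk))
      exact (p.isPrime.mem_or_mem h1).resolve_left hp
  exact hp (chY_self c ▸ hY c)

theorem quasiCompact_toSpecZ_chSS (hG : Monoid.FG G) : QuasiCompact (toSpecZ (chSS G)) := by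
  obtain ⟨S, hS⟩ := hG.fg_top
  have hc : IsCompact (chSSOpen G : Set (chRk G)) := by
    have h1 : (chSSOpen G : Set (chRk G)) =
        ⋃ s ∈ (S : Set G), (PrimeSpectrum.basicOpen (discCh s) : Set (PrimeSpectrum _)) := by
      refine (congrArg (fun U : TopologicalSpace.Opens (PrimeSpectrum (A2rkCh G)) =>
        (U : Set (PrimeSpectrum (A2rkCh G)))) (chSSOpen_eq_iSup hS)).trans ?_
      simp only [TopologicalSpace.Opens.coe_iSup]
    rw [h1]
    exact S.finite_toSet.isCompact_biUnion fun s _ => PrimeSpectrum.isCompact_basicOpen _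
  have : CompactSpace (chSS G) := isCompact_iff_compactSpace.mp hc
  infer_instance

theorem locallyOfFiniteType_toSpecZ_chSS (hG : Monoid.FG G) :
    LocallyOfFiniteType (toSpecZ (chSS G)) := by
  -- `U c` is the basic open set at `c`, as an open subscheme; it is isomorphic by `j` to an open
  -- subscheme of the spectrum of the localization.
  let i (c : G) : Spec (CommRingCat.of (Localization.Away (discCh c))) ⟶ chRk G :=
    Spec.map (CommRingCat.ofHom (algebraMap (A2rkCh G) _))
  have hi (c : G) : IsOpenImmersion (i c) :=
    inferInstanceAs (IsOpenImmersion (Spec.map (CommRingCat.ofHom (algebraMap (A2rkCh G) _))))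
  have hrange (c : G) : Set.range (i c) =
      (PrimeSpectrum.basicOpen (discCh c) : Set (PrimeSpectrum (A2rkCh G))) :=
    PrimeSpectrum.localization_away_comap_range _ _
  let U (c : G) : (chSS G).Opens := chSSι G ⁻¹ᵁ (i c).opensRange
  have hU : iSup U = ⊤ := by
    refine eq_top_iff.mpr fun x _ => ?_
    obtain ⟨c, hc⟩ := TopologicalSpace.Opens.mem_iSup.mp x.2
    exact TopologicalSpace.Opens.mem_iSup.mpr ⟨c, (hrange c).ge hc⟩
  have := HasRingHomProperty.instIsZariskiLocalAtSource (P := @LocallyOfFiniteType.{u})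
    (Q := RingHom.FiniteType)
  refine (IsZariskiLocalAtSource.iff_of_iSup_eq_top (P := @LocallyOfFiniteType.{u}) U hU).mpr
    fun c => ?_
  have hsub : Set.range ((U c).ι ≫ chSSι G) ⊆ Set.range (i c) := by
    rintro _ ⟨x, rfl⟩
    exact x.2
  let j := IsOpenImmersion.lift (i c) ((U c).ι ≫ chSSι G) hsub
  have hj : j ≫ i c = (U c).ι ≫ chSSι G := IsOpenImmersion.lift_fac _ _ _
  have : IsOpenImmersion (j ≫ i c) := hj ▸ inferInstance
  have : IsOpenImmersion j := IsOpenImmersion.of_comp j (i c)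
  obtain ⟨ψ, -⟩ := Spec.map_surjective
    (toSpecZ (Spec (CommRingCat.of (Localization.Away (discCh c)))))
  have hfac : (U c).ι ≫ toSpecZ (chSS G) = j ≫ Spec.map ψ := specULiftZIsTerminal.hom_ext _ _
  have : LocallyOfFiniteType (Spec.map ψ) :=
    (HasRingHomProperty.Spec_iff (P := @LocallyOfFiniteType.{u})).mpr
      (finiteType_away_discCh hG c ψ.hom)
  rw [hfac]
  infer_instance

end finiteness

end SSMold

theorem mainTheorem1 (G : Type u) [Monoid G] :
    (∃ r : (SSMold.eqSS G).RepresentableBy (SSMold.chSS G),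
      ∀ (X : Scheme.{u}) (ρ : SSMold.SSRep G X),
        SSMold.IsCharacterOf (r.homEquiv.symm (SSMold.eqSSClass ρ)) ρ) ∧
    (∀ X : Scheme.{u},
      ∃ e : (X ⟶ SSMold.chSS G) ≃ Quot (SSMold.GenRep.Equivalent (G := G) (X := X)),
        ∀ (s : SSMold.GenRep G X), ∀ p ∈ s.1,
          SSMold.IsCharacterOf (p.1.ι ≫ e.symm (Quot.mk _ s)) p.2) ∧
    IsSeparated (SSMold.toSpecZ (SSMold.chSS G)) ∧
    (Monoid.FG G →
      LocallyOfFiniteType (SSMold.toSpecZ (SSMold.chSS G)) ∧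
        QuasiCompact (SSMold.toSpecZ (SSMold.chSS G))) := by
  refine ⟨⟨SSMold.eqSSRepresentableBy G, fun X ρ => SSMold.isCharacterOf_homEquiv_symm ρ⟩,
    fun X => ⟨SSMold.homEquivGenRep G X, fun s p hp => s.isCharacterOf_hom p hp⟩, inferInstance,
    fun hG => ⟨SSMold.locallyOfFiniteType_toSpecZ_chSS hG, SSMold.quasiCompact_toSpecZ_chSS hG⟩⟩
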